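/- Let $\mathbb S^2\subset\mathbb R^3$ be the unit sphere with its surface area measure. An antipodal lawn is a measurable set $L\subset\mathbb S^2$ such that, for every $x\in\mathbb S^2$, $x\in L$ if and only if $-x\notin L$. A hemispherical lawn is an antipodal lawn that contains an open hemisphere $\{x\in\mathbb S^2:\langle n,x\rangle>0\}$ for some $n\in\mathbb S^2$ (so it is this open hemisphere together with one point of each antipodal pair on its boundary circle). For an antipodal lawn $L$ and a jump size $\phi$, the retention probability of $L$ is the probability that $y\in L$, where $x$ is uniformly distributed on $L$ and $y$ is obtained from $x$ by a jump of spherical length $\phi$ in a uniformly distributed direction, i.e. $y$ is uniformly distributed on the circle of spherical radius $\phi$ about $x$. Let $0<\phi<\pi/2$ and let $H$ be a hemispherical lawn. Then $H$ maximises the retention probability for jumps of size $\phi$ among all antipodal lawns if and only if $\phi=\pi/q$ for some integer $q>1$. -/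

import Mathlib

open Real MeasureTheory ProbabilityTheory
open scoped Matrix

noncomputable section

namespace Grasshopper

/-- The unit sphere `𝕊²` of Euclidean three-space. -/
abbrev S2 : Type := Metric.sphere (0 : EuclideanSpace ℝ (Fin 3)) 1

/-- The surface area measure on the unit sphere (of total mass `4π`). -/
def area : Measure S2 := (volume : Measure (EuclideanSpace ℝ (Fin 3))).toSphere

/-- A unit tangent vector at `x`: the one pointing along the parallel of `x`, and a fixed
horizontal one if `x` is one of the two poles. It is the direction from which the jump
angle `ω` is measured. -/
def tangentDir (x : S2) : EuclideanSpace ℝ (Fin 3) :=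
  if x.1 0 = 0 ∧ x.1 1 = 0 then !₂[1, 0, 0]
  else (√(x.1 0 ^ 2 + x.1 1 ^ 2))⁻¹ • !₂[-x.1 1, x.1 0, 0]

/-- The unit tangent vector at `x` that completes `x`, `tangentDir x` to a positively
oriented orthonormal basis: the cross product of the two. -/
def tangentPerp (x : S2) : EuclideanSpace ℝ (Fin 3) :=
  WithLp.toLp 2 (x.1.ofLp ⨯₃ (tangentDir x).ofLp)

lemma sq_add_sq_add_sq (x : S2) : x.1 0 ^ 2 + x.1 1 ^ 2 + x.1 2 ^ 2 = 1 := by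
  have h : ‖x.1‖ = 1 := by simp
  have h2 : ‖x.1‖ ^ 2 = 1 := by rw [h]; norm_num
  rw [EuclideanSpace.real_norm_sq_eq, Fin.sum_univ_three] at h2
  exact h2

lemma tangentDir_spec (x : S2) :
    tangentDir x 0 ^ 2 + tangentDir x 1 ^ 2 + tangentDir x 2 ^ 2 = 1 ∧
    x.1 0 * tangentDir x 0 + x.1 1 * tangentDir x 1 + x.1 2 * tangentDir x 2 = 0 := by
  unfold tangentDir
  split_ifs with h
  · simp [h.1]
  · have hp : 0 < x.1 0 ^ 2 + x.1 1 ^ 2 := by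
      rcases not_and_or.mp h with h | h <;> positivity
    have hs := Real.sq_sqrt hp.le
    have hs0 : √(x.1 0 ^ 2 + x.1 1 ^ 2) ≠ 0 := (Real.sqrt_pos.mpr hp).ne'
    constructor
    · simp
      field_simp
      rw [hs]; ring
    · simp
      ring

lemma jump_mem (φ : ℝ) (x : S2) (ω : ℝ) :
    cos φ • x.1 + sin φ • (cos ω • tangentDir x + sin ω • tangentPerp x) ∈
      Metric.sphere (0 : EuclideanSpace ℝ (Fin 3)) 1 := by
  have hx := sq_add_sq_add_sq x
  obtain ⟨hu, hxu⟩ := tangentDir_spec x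
  have h1 := Real.sin_sq_add_cos_sq φ
  have h2 := Real.sin_sq_add_cos_sq ω
  rw [mem_sphere_zero_iff_norm, ← sq_eq_sq₀ (norm_nonneg _) zero_le_one,
    EuclideanSpace.real_norm_sq_eq, Fin.sum_univ_three]
  simp only [tangentPerp, cross_apply, PiLp.add_apply, PiLp.smul_apply, smul_eq_mul,
    Matrix.cons_val_zero, Matrix.cons_val_one, Matrix.cons_val]
  generalize x.1 0 = a at *
  generalize x.1 1 = b at *
  generalize x.1 2 = c at *
  generalize tangentDir x 0 = u at *
  generalize tangentDir x 1 = v at *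
  generalize tangentDir x 2 = w at *
  generalize cos φ = C at *
  generalize sin φ = S at *
  generalize cos ω = k at *
  generalize sin ω = l at *
  linear_combination (C ^ 2 + S ^ 2 * l ^ 2 * (u ^ 2 + v ^ 2 + w ^ 2)) * hx
    + (S ^ 2 * k ^ 2 + S ^ 2 * l ^ 2) * hu
    + (2 * C * S * k - S ^ 2 * l ^ 2 * (a * u + b * v + c * w)) * hxu
    + h1 + S ^ 2 * h2

/-- The point reached from `x` by a jump through the spherical angle `φ` in the direction
`ω`. For `0 < φ < π`, as `ω` runs over `[0, 2π)`, it runs at constant speed once around the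
circle of spherical radius `φ` about `x`. -/
def jump (φ : ℝ) (x : S2) (ω : ℝ) : S2 :=
  ⟨cos φ • x.1 + sin φ • (cos ω • tangentDir x + sin ω • tangentPerp x), jump_mem φ x ω⟩

/-- An antipodal lawn: a measurable set that contains exactly one of each pair of opposite
points of the sphere. -/
structure IsAntipodalLawn (L : Set S2) : Prop where
  measurableSet : MeasurableSet L
  mem_iff : ∀ x : S2, x ∈ L ↔ -x ∉ L

/-- A hemispherical lawn: an antipodal lawn that contains the open hemisphere about some
pole `n`. By antipodality, it is this open hemisphere together with one of each pair of
opposite points of the bounding great circle. -/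
structure IsHemisphericalLawn (H : Set S2) : Prop extends IsAntipodalLawn H where
  exists_pole : ∃ n : S2, {x : S2 | 0 < inner ℝ n.1 x.1} ⊆ H

/-- Hemispherical lawns exist. -/
lemma exists_isHemisphericalLawn : ∃ H : Set S2, IsHemisphericalLawn H := by
  have hm : ∀ i : Fin 3, Measurable fun x : S2 => x.1 i := fun i =>
    Continuous.measurable (by fun_prop)
  refine ⟨{x | 0 < x.1 2 ∨ (x.1 2 = 0 ∧ (0 < x.1 1 ∨ (x.1 1 = 0 ∧ 0 < x.1 0)))},
    ⟨?_, fun x => ?_⟩, ⟨⟨!₂[0, 0, 1], ?_⟩, ?_⟩⟩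
  · have hp : ∀ i : Fin 3, MeasurableSet {x : S2 | 0 < x.1 i} := fun i =>
      measurableSet_lt measurable_const (hm i)
    have hz : ∀ i : Fin 3, MeasurableSet {x : S2 | x.1 i = 0} := fun i =>
      measurableSet_eq_fun (hm i) measurable_const
    exact (hp 2).union ((hz 2).inter ((hp 1).union ((hz 1).inter (hp 0))))
  · have h := sq_add_sq_add_sq x
    rw [Set.mem_ofPred_eq, Set.mem_ofPred_eq]
    have hn : ∀ i : Fin 3, (-x).1 i = -x.1 i := fun i => rfl
    simp only [hn]
    generalize x.1 0 = a at *
    generalize x.1 1 = b at *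
    generalize x.1 2 = c at *
    rcases lt_trichotomy c 0 with hc | hc | hc <;>
    rcases lt_trichotomy b 0 with hb | hb | hb <;>
    rcases lt_trichotomy a 0 with ha | ha | ha <;>
    first
      | (subst hc hb ha; norm_num at h)
      | simp [hc, hb, ha, hc.ne, hb.ne, ha.ne, hc.ne', hb.ne', ha.ne', not_lt_of_gt]
      | simp_all [ne_of_lt, ne_of_gt, le_of_lt, not_lt_of_gt]
  · simp [EuclideanSpace.norm_eq, Fin.sum_univ_three]
  · intro x hx
    left
    simpa [PiLp.inner_apply, Fin.sum_univ_three] using hx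

/-- The retention probability of the lawn `L` for jumps of size `φ`: the probability that
`jump φ x ω` lies on `L`, when `x` is uniformly distributed on `L` and, independently, the
direction `ω` is uniformly distributed on `[0, 2π)`. -/
def retentionProb (φ : ℝ) (L : Set S2) : ℝ :=
  ((cond area L).prod (cond (volume : Measure ℝ) (Set.Ico 0 (2 * π)))).real
    {p : S2 × ℝ | jump φ p.1 p.2 ∈ L}

end Grasshopper

end

namespace Grasshopper

open Filter Topology
open scoped Pointwise

/-! The antipodal symmetry makes maximising retention the same as minimising the probability that a
jump separates, that is, has exactly one end on the lawn (`retentionProb_eq`). The joint law of the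
two ends is the image of Haar measure on the orthogonal group under `g ↦ (g a, g b)`, for any fixed
pair `a, b` at angle `φ` (`pairMeasure_eq_map_haarO3`).

If `φ = π / q`, a chain of `q` jumps along a great circle leads from a point to its antipode, where
membership flips. Hence at least one jump of every rotated chain separates, and since all jumps of
the chain have the same law, the separation probability is at least `1 / q` (`separated_chain`,
`one_le_sum_haarO3_separated`). A great semicircle almost surely crosses the boundary of a
hemisphere at most once, so hemispheres attain this bound (`sum_haarO3_separated_hemisphere_le`).

If `φ` is not of this form, some odd `k` has `cos (k φ) > cos φ` (`exists_odd_cos_lt`). Replace the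
equator by the wave of height `ε Re (x₀ + i x₁) ^ k`; as `k` is odd, the region above it is again an
antipodal lawn. Only starts within `O(ε)` of the equator matter. For these, the correlation with the
hemisphere, averaged over directions, is of order `ε`; the correlation of the perturbation with
itself uses directions in a window of width `O(ε)`. So the gain has order `ε²`. For each half circle
of directions its coefficient is `4π / |sin φ| * (cos (k φ) - cos φ)` (`tendsto_halfGain`): the
first cosine is the correlation of the wave with its shift by `φ`, the second is the cost of leaving
the hemisphere. A positive coefficient makes the wavy lawn better for small `ε`. -/

/-! ### The orthogonal group and its action on the sphere -/

/-- Euclidean three-space. -/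
abbrev E3 : Type := EuclideanSpace ℝ (Fin 3)

/-- The orthogonal group of Euclidean three-space. -/
abbrev O3 : Type := unitary (E3 →L[ℝ] E3)

noncomputable instance : MeasurableSpace O3 := borel O3

instance : BorelSpace O3 := ⟨rfl⟩

lemma properSpace_endE3 : ProperSpace (E3 →L[ℝ] E3) := FiniteDimensional.proper ℝ _

instance : ContinuousStar (E3 →L[ℝ] E3) :=
  ⟨(ContinuousLinearMap.adjoint (𝕜 := ℝ) (E := E3) (F := E3)).continuous⟩

instance : SecondCountableTopology (E3 →L[ℝ] E3) :=
  have := properSpace_endE3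
  secondCountable_of_proper

instance : CompactSpace O3 := by
  have := properSpace_endE3
  have hc : IsClosed ((unitary (E3 →L[ℝ] E3) : Submonoid _) : Set (E3 →L[ℝ] E3)) :=
    isClosed_unitary
  refine isCompact_iff_compactSpace.mp (Metric.isCompact_of_isClosed_isBounded hc ?_)
  refine (Metric.isBounded_closedBall (x := (0 : E3 →L[ℝ] E3)) (r := 1)).subset fun u hu => ?_
  rw [mem_closedBall_zero_iff]
  exact ContinuousLinearMap.opNorm_le_bound _ zero_le_one fun x => by
    rw [one_mul]; exact (u.norm_map_of_mem_unitary hu x).le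

/-- The orthogonal group acts on the sphere. -/
def act (g : O3) (x : S2) : S2 :=
  ⟨g.1 x.1, by
    rw [mem_sphere_zero_iff_norm, g.1.norm_map_of_mem_unitary g.2, norm_eq_of_mem_sphere]⟩

lemma coe_act (g : O3) (x : S2) : (act g x).1 = g.1 x.1 := rfl

lemma act_mul (g h : O3) (x : S2) : act (g * h) x = act g (act h x) := rfl

lemma act_neg (g : O3) (x : S2) : act g (-x) = -act g x :=
  Subtype.ext (map_neg g.1 x.1)

lemma inner_act (g : O3) (x y : S2) : inner ℝ (act g x).1 (act g y).1 = inner ℝ x.1 y.1 :=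
  g.1.inner_map_map_of_mem_unitary g.2 _ _

lemma continuous_act : Continuous fun p : O3 × S2 => act p.1 p.2 :=
  Continuous.subtype_mk ((continuous_subtype_val.comp continuous_fst).clm_apply
    (continuous_subtype_val.comp continuous_snd)) _

lemma measurable_act : Measurable fun p : O3 × S2 => act p.1 p.2 :=
  continuous_act.measurable

/-- The invariant probability measure of the orthogonal group. -/
noncomputable def haarO3 : Measure O3 := Measure.haarMeasure ⊤

instance : Measure.IsHaarMeasure haarO3 := Measure.isHaarMeasure_haarMeasure _

instance : IsProbabilityMeasure haarO3 :=
  ⟨Measure.haarMeasure_self (K₀ := (⊤ : TopologicalSpace.PositiveCompacts O3))⟩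

/-- Compact groups are unimodular: the right translate is again a left Haar probability measure,
hence the same one by uniqueness. -/
lemma haarO3_map_mul_right (r : O3) : haarO3.map (· * r) = haarO3 := by
  have : IsProbabilityMeasure (haarO3.map (· * r)) :=
    Measure.isProbabilityMeasure_map (measurable_mul_const r).aemeasurable
  have : Measure.IsHaarMeasure (haarO3.map (· * r)) := Measure.isHaarMeasure_map_mul_right _ r
  exact Measure.isHaarMeasure_eq_of_isProbabilityMeasure _ _

lemma inner_eq_sum (x y : E3) : inner ℝ x y = x 0 * y 0 + x 1 * y 1 + x 2 * y 2 := by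
  simp [PiLp.inner_apply, Fin.sum_univ_three]; ring

/-- Both pairs have the same coordinates in orthonormal bases adapted to them: the first point is a
basis vector, and the second is `cos φ` and `sin φ` times the first two basis vectors. The change of
basis is the required map. A nonzero sine allows the second basis vector to be normalised. -/
lemma exists_act_pair {a b a' b' : S2} {φ : ℝ} (hφ : sin φ ≠ 0)
    (h : inner ℝ a.1 b.1 = cos φ) (h' : inner ℝ a'.1 b'.1 = cos φ) :
    ∃ r : O3, act r a = a' ∧ act r b = b' := by
  have key : ∀ a b : S2, inner ℝ a.1 b.1 = cos φ → ∃ v : OrthonormalBasis (Fin 3) ℝ E3,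
      v 0 = a.1 ∧ b.1 = cos φ • v 0 + sin φ • v 1 := by
    intro a b h
    set t : E3 := (sin φ)⁻¹ • (b.1 - cos φ • a.1) with ht
    have ha : inner ℝ a.1 a.1 = 1 := by simp
    have hb : inner ℝ b.1 b.1 = 1 := by simp
    have hat : inner ℝ a.1 t = 0 := by
      rw [ht, inner_smul_right, inner_sub_right, inner_smul_right, h, ha]; ring
    have htt : inner ℝ t t = 1 := by
      rw [ht]
      simp only [inner_smul_right, inner_smul_left, inner_sub_right, inner_sub_left, h, ha, hb,
        real_inner_comm a.1 b.1]
      simp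
      field_simp
      linear_combination -(Real.sin_sq_add_cos_sq φ)
    have hn : ‖t‖ = 1 := by
      rw [← sq_eq_sq₀ (norm_nonneg _) zero_le_one, ← real_inner_self_eq_norm_sq, htt]; norm_num
    have ho : Orthonormal ℝ (Set.domRestrict ({0, 1} : Set (Fin 3)) ![a.1, t, 0]) := by
      have h0 : ![a.1, t, 0] 0 = a.1 := rfl
      have h1 : ![a.1, t, 0] 1 = t := rfl
      constructor
      · rintro ⟨i, hi⟩
        rw [Set.domRestrict_apply]
        rcases hi with rfl | rfl
        · simp
        · simpa using hn
      · rintro ⟨i, hi⟩ ⟨j, hj⟩ hij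
        rw [Set.domRestrict_apply, Set.domRestrict_apply]
        rcases hi with rfl | rfl <;> rcases hj with rfl | rfl
        · exact absurd rfl hij
        · simpa using hat
        · simpa [real_inner_comm] using hat
        · exact absurd rfl hij
    obtain ⟨v, hv⟩ := ho.exists_orthonormalBasis_extension_of_card_eq (by simp)
    refine ⟨v, hv 0 (by simp), ?_⟩
    rw [hv 0 (by simp), hv 1 (by simp)]
    simp [ht, smul_smul, hφ]
  obtain ⟨v, hv, hv'⟩ := key a b h
  obtain ⟨w, hw, hw'⟩ := key a' b' h'
  set U := v.equiv w (Equiv.refl _) with hU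
  have hUv : ∀ i, U (v i) = w i := fun i => by simp [hU]
  refine ⟨Unitary.linearIsometryEquiv.symm U, Subtype.ext ?_, Subtype.ext ?_⟩
  · change U a.1 = a'.1
    rw [← hv, hUv, hw]
  · change U b.1 = b'.1
    rw [hv', map_add, map_smul, map_smul, hUv, hUv, hw']

lemma haarO3_map_pair_eq {a b a' b' : S2} {φ : ℝ} (hφ : sin φ ≠ 0)
    (h : inner ℝ a.1 b.1 = cos φ) (h' : inner ℝ a'.1 b'.1 = cos φ) :
    haarO3.map (fun g => (act g a, act g b)) = haarO3.map (fun g => (act g a', act g b')) := by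
  obtain ⟨r, rfl, rfl⟩ := exists_act_pair hφ h h'
  conv_lhs => rw [← haarO3_map_mul_right r]
  have hm : ∀ x : S2, Measurable fun g : O3 => act g x := fun x =>
    measurable_act.comp (measurable_id.prodMk measurable_const)
  rw [Measure.map_map ((hm a).prodMk (hm b)) (measurable_mul_const r)]
  rfl

/-- The area of `s` is a multiple of the volume of the cone over `s`, and linear isometries carry
cones to cones and preserve volume. -/
lemma area_map_act (g : O3) : area.map (act g) = area := by
  have hm : Measurable (act g) := measurable_act.comp (measurable_const.prodMk measurable_id)
  set U : E3 ≃ₗᵢ[ℝ] E3 := Unitary.linearIsometryEquiv g with hU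
  have hUx : ∀ x : S2, U x.1 = (act g x).1 := fun x => rfl
  ext s hs
  rw [Measure.map_apply hm hs, area, Measure.toSphere_apply' _ (hm hs),
    Measure.toSphere_apply' _ hs]
  congr 1
  rw [← U.measurePreserving.measure_preimage_equiv
    (f := U.toHomeomorph.toMeasurableEquiv) (s := Set.Ioo (0 : ℝ) 1 • (Subtype.val '' s))]
  congr 1
  ext y
  constructor
  · rintro ⟨c, hc, _, ⟨x, hx, rfl⟩, rfl⟩
    exact ⟨c, hc, _, ⟨act g x, hx, rfl⟩, by simp [← hUx]⟩
  · rintro ⟨c, hc, _, ⟨x, hx, rfl⟩, h⟩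
    have hgx : act g (act g⁻¹ x) = x := by
      rw [← act_mul, mul_inv_cancel]; rfl
    refine ⟨c, hc, _, ⟨act g⁻¹ x, by rwa [Set.mem_preimage, hgx], rfl⟩, ?_⟩
    apply U.injective
    change U (c • _) = U y
    rw [map_smul, hUx, hgx]
    exact h

/-! ### Tangent frames and their behaviour under orthogonal maps -/

lemma measurable_tangentDir : Measurable tangentDir := by
  unfold tangentDir
  have hc : ∀ i : Fin 3, Measurable fun x : S2 => x.1 i := fun i =>
    Continuous.measurable (by fun_prop)
  refine Measurable.ite ?_ measurable_const ?_
  · exact (measurableSet_eq_fun (hc 0) measurable_const).inter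
      (measurableSet_eq_fun (hc 1) measurable_const)
  · refine Measurable.smul (f := fun x : S2 => (√(x.1 0 ^ 2 + x.1 1 ^ 2))⁻¹) ?_ ?_
    · exact ((((hc 0).pow_const 2).add ((hc 1).pow_const 2)).sqrt).inv
    refine (WithLp.measurable_toLp 2 _).comp (measurable_pi_lambda _ fun i => ?_)
    fin_cases i
    · exact (hc 1).neg
    · exact hc 0
    · exact measurable_const

lemma measurable_tangentPerp : Measurable tangentPerp := by
  refine (WithLp.measurable_toLp 2 _).comp (measurable_pi_lambda _ fun i => ?_)
  have hc : ∀ i : Fin 3, Measurable fun x : S2 => x.1 i := fun i =>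
    Continuous.measurable (by fun_prop)
  have ht : ∀ i : Fin 3, Measurable fun x : S2 => tangentDir x i := fun i =>
    (Continuous.measurable (f := fun v : E3 => v i) (by fun_prop)).comp measurable_tangentDir
  simp only [cross_apply]
  fin_cases i
  · exact ((hc 1).mul (ht 2)).sub ((hc 2).mul (ht 1))
  · exact ((hc 2).mul (ht 0)).sub ((hc 0).mul (ht 2))
  · exact ((hc 0).mul (ht 1)).sub ((hc 1).mul (ht 0))

lemma measurable_jump (φ : ℝ) : Measurable fun p : S2 × ℝ => jump φ p.1 p.2 := by
  have h1 : Measurable fun p : S2 × ℝ => tangentDir p.1 := measurable_tangentDir.comp measurable_fst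
  have h2 : Measurable fun p : S2 × ℝ => tangentPerp p.1 :=
    measurable_tangentPerp.comp measurable_fst
  refine Measurable.subtype_mk ?_
  refine ((measurable_subtype_coe.comp measurable_fst).const_smul (cos φ)).add
    (Measurable.const_smul (Measurable.add ?_ ?_) (sin φ))
  · exact (measurable_cos.comp measurable_snd).smul h1
  · exact (measurable_sin.comp measurable_snd).smul h2

lemma inner_tangentDir (x : S2) : inner ℝ x.1 (tangentDir x) = 0 := by
  rw [inner_eq_sum]; exact (tangentDir_spec x).2

lemma inner_tangentDir_self (x : S2) : inner ℝ (tangentDir x) (tangentDir x) = 1 := by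
  rw [inner_eq_sum]; linear_combination (tangentDir_spec x).1

lemma inner_tangentPerp (x : S2) : inner ℝ x.1 (tangentPerp x) = 0 := by
  rw [inner_eq_sum]; simp [tangentPerp, cross_apply]; ring

lemma inner_tangentDir_tangentPerp (x : S2) : inner ℝ (tangentDir x) (tangentPerp x) = 0 := by
  rw [inner_eq_sum]; simp [tangentPerp, cross_apply]; ring

lemma inner_tangentPerp_self (x : S2) : inner ℝ (tangentPerp x) (tangentPerp x) = 1 := by
  have h1 := sq_add_sq_add_sq x
  obtain ⟨h2, h3⟩ := tangentDir_spec x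
  rw [inner_eq_sum]; simp [tangentPerp, cross_apply]
  generalize x.1 0 = a at *
  generalize x.1 1 = b at *
  generalize x.1 2 = c at *
  generalize tangentDir x 0 = u at *
  generalize tangentDir x 1 = v at *
  generalize tangentDir x 2 = w at *
  linear_combination (u ^ 2 + v ^ 2 + w ^ 2) * h1 + h2 - (a * u + b * v + c * w) * h3

lemma inner_jump (φ : ℝ) (x : S2) (ω : ℝ) : inner ℝ x.1 (jump φ x ω).1 = cos φ := by
  change inner ℝ x.1 (cos φ • x.1 + sin φ • (cos ω • tangentDir x + sin ω • tangentPerp x)) = _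
  simp only [inner_add_right, inner_smul_right, inner_tangentDir, inner_tangentPerp]
  simp

/-- A vector orthogonal to `x` is a combination of the two tangent vectors. -/
lemma eq_tangent_combination (x : S2) {v : E3} (h : inner ℝ x.1 v = 0) :
    v = inner ℝ (tangentDir x) v • tangentDir x + inner ℝ (tangentPerp x) v • tangentPerp x := by
  have h1 : ‖tangentDir x‖ = 1 := by
    rw [← sq_eq_sq₀ (norm_nonneg _) zero_le_one, ← real_inner_self_eq_norm_sq,
      inner_tangentDir_self, one_pow]
  have h2 : ‖tangentPerp x‖ = 1 := by
    rw [← sq_eq_sq₀ (norm_nonneg _) zero_le_one, ← real_inner_self_eq_norm_sq,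
      inner_tangentPerp_self, one_pow]
  have ho : Orthonormal ℝ ![x.1, tangentDir x, tangentPerp x] := by
    rw [orthonormal_iff_ite]
    intro i j
    fin_cases i <;> fin_cases j <;>
      simp [inner_tangentDir, inner_tangentPerp, inner_tangentDir_tangentPerp,
        real_inner_comm x.1, real_inner_comm (tangentDir x) (tangentPerp x), h1, h2]
  set b := OrthonormalBasis.mk ho (by
    rw [ho.linearIndependent.span_eq_top_of_card_eq_finrank' (by simp)]) with hb
  have hs := b.sum_repr' v
  rw [Fin.sum_univ_three] at hs
  simpa [hb, h] using hs.symm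

/-- An orthogonal map carries the direction circle at `x` to the one at the image of `x`,
up to a rotation and possibly a reflection. -/
lemma exists_act_jump (g : O3) (x : S2) : ∃ (c σ : ℝ), (σ = 1 ∨ σ = -1) ∧
    ∀ φ ω, act g (jump φ x ω) = jump φ (act g x) (σ * ω + c) := by
  have hg : ∀ v w : E3, inner ℝ (g.1 v) (g.1 w) = inner ℝ v w :=
    g.1.inner_map_map_of_mem_unitary g.2
  set y := act g x with hy
  have hyg : y.1 = g.1 x.1 := rfl
  have e1 := eq_tangent_combination y (v := g.1 (tangentDir x))
    (by rw [hyg, hg, inner_tangentDir])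
  have e2 := eq_tangent_combination y (v := g.1 (tangentPerp x))
    (by rw [hyg, hg, inner_tangentPerp])
  -- The numbers `p, q, r, s` are the matrix of `g` between the tangent frames at `x` and `y`. It is
  -- orthogonal, so `(p, q) = (cos c, sin c)`, and the other column is determined by the determinant
  -- `σ = ±1`.
  generalize inner ℝ (tangentDir y) (g.1 (tangentDir x)) = p at e1
  generalize inner ℝ (tangentPerp y) (g.1 (tangentDir x)) = q at e1
  generalize inner ℝ (tangentDir y) (g.1 (tangentPerp x)) = r at e2
  generalize inner ℝ (tangentPerp y) (g.1 (tangentPerp x)) = s at e2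
  have hcomm : inner ℝ (tangentPerp y) (tangentDir y) = 0 := by
    rw [real_inner_comm, inner_tangentDir_tangentPerp]
  have h11 : p ^ 2 + q ^ 2 = 1 := by
    have := hg (tangentDir x) (tangentDir x)
    rw [e1] at this
    simp only [inner_add_left, inner_add_right, inner_smul_left, inner_smul_right,
      inner_tangentDir_self, inner_tangentPerp_self, inner_tangentDir_tangentPerp, hcomm] at this
    simp at this
    linear_combination this
  have h12 : p * r + q * s = 0 := by
    have := hg (tangentDir x) (tangentPerp x)
    rw [e1, e2] at this
    simp only [inner_add_left, inner_add_right, inner_smul_left, inner_smul_right,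
      inner_tangentDir_self, inner_tangentPerp_self, inner_tangentDir_tangentPerp, hcomm] at this
    simp at this
    linear_combination this
  have h22 : r ^ 2 + s ^ 2 = 1 := by
    have := hg (tangentPerp x) (tangentPerp x)
    rw [e2] at this
    simp only [inner_add_left, inner_add_right, inner_smul_left, inner_smul_right,
      inner_tangentDir_self, inner_tangentPerp_self, inner_tangentDir_tangentPerp, hcomm] at this
    simp at this
    linear_combination this
  have hd : (p * s - q * r) ^ 2 = 1 := by
    linear_combination (r ^ 2 + s ^ 2) * h11 + h22 - (p * r + q * s) * h12
  obtain ⟨c, hc, hs⟩ : ∃ c, cos c = p ∧ sin c = q := by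
    have hz : ‖(⟨p, q⟩ : ℂ)‖ = 1 := by
      rw [← sq_eq_sq₀ (norm_nonneg _) zero_le_one, Complex.sq_norm, Complex.normSq_mk]
      linear_combination h11
    refine ⟨Complex.arg ⟨p, q⟩, ?_, ?_⟩
    · rw [Complex.cos_arg (by rw [← norm_pos_iff, hz]; norm_num), hz]; simp
    · rw [Complex.sin_arg, hz]; simp
  refine ⟨c, p * s - q * r, (sq_eq_one_iff.mp hd), fun φ ω => Subtype.ext ?_⟩
  generalize hσ : p * s - q * r = σ at hd ⊢
  have hr : r = -q * σ := by rw [← hσ]; linear_combination -r * h11 + p * h12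
  have hs' : s = p * σ := by rw [← hσ]; linear_combination -s * h11 + q * h12
  have hcos : cos (σ * ω + c) = cos ω * p - σ * sin ω * q := by
    rw [cos_add, hc, hs]
    rcases (sq_eq_one_iff.mp hd) with h | h <;> simp [h]
  have hsin : sin (σ * ω + c) = σ * sin ω * p + cos ω * q := by
    rw [sin_add, hc, hs]
    rcases (sq_eq_one_iff.mp hd) with h | h <;> simp [h]
  change g.1 (cos φ • x.1 + sin φ • (cos ω • tangentDir x + sin ω • tangentPerp x)) =
    cos φ • y.1 + sin φ • (cos (σ * ω + c) • tangentDir y + sin (σ * ω + c) • tangentPerp y)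
  rw [map_add, map_smul, map_smul, map_add, map_smul, map_smul, e1, e2, ← hyg, hcos, hsin, hr, hs']
  module

/-! ### The joint law of the two ends of a jump -/

/-- The (unnormalised) joint law of start and end of a jump of size `φ`. -/
noncomputable def pairMeasure (φ : ℝ) : Measure (S2 × S2) :=
  (area.prod (volume.restrict (Set.Ico 0 (2 * π)))).map fun p => (p.1, jump φ p.1 p.2)

instance : IsFiniteMeasure area := by unfold area; infer_instance

lemma area_univ_ne_zero : area Set.univ ≠ 0 := by
  have := Measure.toSphere_ne_zero (volume : Measure E3)
  rwa [Ne, Measure.measure_univ_eq_zero]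

lemma measurable_pair (φ : ℝ) : Measurable fun p : S2 × ℝ => (p.1, jump φ p.1 p.2) :=
  measurable_fst.prodMk (measurable_jump φ)

instance (φ : ℝ) : IsFiniteMeasure (pairMeasure φ) := by unfold pairMeasure; infer_instance

lemma pairMeasure_univ (φ : ℝ) :
    pairMeasure φ Set.univ = area Set.univ * ENNReal.ofReal (2 * π) := by
  rw [pairMeasure, Measure.map_apply (measurable_pair φ) MeasurableSet.univ, Set.preimage_univ,
    ← Set.univ_prod_univ, Measure.prod_prod, Measure.restrict_apply_univ, Real.volume_Ico, sub_zero]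

lemma jump_periodic (φ : ℝ) (x : S2) : Function.Periodic (jump φ x) (2 * π) := fun ω =>
  Subtype.ext (by simp [jump])

lemma lintegral_Ico_periodic {f : ℝ → ENNReal} (hf : Function.Periodic f (2 * π)) (a b : ℝ) :
    ∫⁻ ω in Set.Ico a (a + 2 * π), f ω = ∫⁻ ω in Set.Ico b (b + 2 * π), f ω := by
  rw [setLIntegral_congr Ico_ae_eq_Ioc, setLIntegral_congr Ico_ae_eq_Ioc]
  have hf' : ∀ (g : AddSubgroup.zmultiples (2 * π)) (x : ℝ), f (g +ᵥ x) = f x := by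
    rintro ⟨_, n, rfl⟩ x
    change f (n • (2 * π) + x) = f x
    rw [add_comm]
    exact hf.zsmul n x
  exact (isAddFundamentalDomain_Ioc two_pi_pos a).setLIntegral_eq
    (isAddFundamentalDomain_Ioc two_pi_pos b) f hf'

lemma lintegral_Ico_affine {f : ℝ → ENNReal} (hf : Function.Periodic f (2 * π)) {σ : ℝ}
    (hσ : σ = 1 ∨ σ = -1) (c : ℝ) :
    ∫⁻ ω in Set.Ico 0 (2 * π), f (σ * ω + c) = ∫⁻ ω in Set.Ico 0 (2 * π), f ω := by
  have h0 := lintegral_Ico_periodic hf 0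
  rw [zero_add] at h0
  rcases hσ with rfl | rfl
  · have := (measurePreserving_add_right volume c).setLIntegral_comp_preimage_emb
      (measurableEmbedding_addRight c) f (Set.Ico c (c + 2 * π))
    rw [h0 c, ← this]
    simp
  · rw [setLIntegral_congr Ico_ae_eq_Ioc]
    have := (Measure.measurePreserving_sub_left volume c).setLIntegral_comp_preimage_emb
      (MeasurableEquiv.subLeft c).measurableEmbedding f (Set.Ico (c - 2 * π) (c - 2 * π + 2 * π))
    rw [h0 (c - 2 * π), ← this]
    simp [neg_add_eq_sub]

/-- The start is moved by an area-preserving map. The direction is rotated and possibly reflected by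
an amount depending on the start, which does not change the integral over a full period. -/
lemma pairMeasure_map_act (φ : ℝ) (g : O3) :
    (pairMeasure φ).map (fun p => (act g p.1, act g p.2)) = pairMeasure φ := by
  have hm : Measurable (act g) := measurable_act.comp (measurable_const.prodMk measurable_id)
  have hm2 : Measurable fun p : S2 × S2 => (act g p.1, act g p.2) :=
    (hm.comp measurable_fst).prodMk (hm.comp measurable_snd)
  refine Measure.ext_of_lintegral _ fun f hf => ?_
  rw [lintegral_map hf hm2, pairMeasure,
    lintegral_map (f := fun p => f (act g p.1, act g p.2)) (hf.comp hm2) (measurable_pair φ),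
    lintegral_map hf (measurable_pair φ),
    lintegral_prod (fun a => f (act g a.1, act g (jump φ a.1 a.2)))
      ((hf.comp hm2).comp (measurable_pair φ)).aemeasurable,
    lintegral_prod (fun a => f (a.1, jump φ a.1 a.2)) (hf.comp (measurable_pair φ)).aemeasurable]
  have hF : Measurable fun x : S2 => ∫⁻ ω in Set.Ico 0 (2 * π), f (x, jump φ x ω) :=
    (hf.comp (measurable_pair φ)).lintegral_prod_right'
  conv_rhs => rw [← area_map_act g, lintegral_map hF hm]
  refine lintegral_congr fun x => ?_
  obtain ⟨c, σ, hσ, h⟩ := exists_act_jump g x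
  simp only [h]
  exact lintegral_Ico_affine (f := fun ω => f (act g x, jump φ (act g x) ω))
    (fun ω => by simp only [jump_periodic φ (act g x) ω]) hσ c

/-- By invariance, integrals against `pairMeasure φ` may first be averaged over all `g`. After
exchanging the integrals, the inner one depends only on the angle between the two points, which is
constantly `φ`, so any pair `a, b` at this angle serves. -/
theorem pairMeasure_eq_map_haarO3 {φ : ℝ} (hφ : sin φ ≠ 0) {a b : S2}
    (hab : inner ℝ a.1 b.1 = cos φ) :
    pairMeasure φ = pairMeasure φ Set.univ • haarO3.map (fun g => (act g a, act g b)) := by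
  have hm : ∀ x : S2, Measurable fun g : O3 => act g x := fun x =>
    measurable_act.comp (measurable_id.prodMk measurable_const)
  have hm1 : Measurable fun p : O3 × (S2 × S2) => (act p.1 p.2.1, act p.1 p.2.2) :=
    (measurable_act.comp (measurable_fst.prodMk (measurable_fst.comp measurable_snd))).prodMk
      (measurable_act.comp (measurable_fst.prodMk (measurable_snd.comp measurable_snd)))
  refine Measure.ext_of_lintegral _ fun f hf => ?_
  have h1 : ∫⁻ g, ∫⁻ p, f (act g p.1, act g p.2) ∂(pairMeasure φ) ∂haarO3 =
      ∫⁻ p, f p ∂(pairMeasure φ) := by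
    have : ∀ g, ∫⁻ p, f (act g p.1, act g p.2) ∂(pairMeasure φ) = ∫⁻ p, f p ∂(pairMeasure φ) := by
      intro g
      conv_rhs => rw [← pairMeasure_map_act φ g]
      have hg : Measurable fun p : S2 × S2 => (act g p.1, act g p.2) :=
        hm1.comp (measurable_const.prodMk measurable_id)
      rw [lintegral_map hf hg]
    simp [this]
  rw [← h1, lintegral_lintegral_swap
      (f := fun (g : O3) (p : S2 × S2) => f (act g p.1, act g p.2)) (hf.comp hm1).aemeasurable,
    lintegral_smul_measure,
    pairMeasure, lintegral_map (by exact (hf.comp hm1).lintegral_prod_left') (measurable_pair φ),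
    ← pairMeasure]
  have h2 : ∀ p : S2 × ℝ, ∫⁻ g, f (act g p.1, act g (jump φ p.1 p.2)) ∂haarO3 =
      ∫⁻ q, f q ∂(haarO3.map (fun g => (act g a, act g b))) := by
    intro p
    rw [haarO3_map_pair_eq hφ hab (inner_jump φ p.1 p.2), lintegral_map hf ((hm _).prodMk (hm _))]
  simp only [h2, lintegral_const, smul_eq_mul]
  rw [mul_comm]
  congr 1
  rw [pairMeasure, Measure.map_apply (measurable_pair φ) MeasurableSet.univ, Set.preimage_univ]

/-- Jumps are reversible, because `(a, b)` and `(b, a)` are equally good base pairs for the Haar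
description. -/
lemma pairMeasure_map_swap {φ : ℝ} (hφ : sin φ ≠ 0) :
    (pairMeasure φ).map Prod.swap = pairMeasure φ := by
  obtain ⟨x⟩ : Nonempty S2 := ⟨⟨!₂[1, 0, 0], by simp [EuclideanSpace.norm_eq, Fin.sum_univ_three]⟩⟩
  have hm : ∀ x : S2, Measurable fun g : O3 => act g x := fun x =>
    measurable_act.comp (measurable_id.prodMk measurable_const)
  conv_lhs => rw [pairMeasure_eq_map_haarO3 hφ (inner_jump φ x 0)]
  conv_rhs => rw [pairMeasure_eq_map_haarO3 hφ
    (a := jump φ x 0) (b := x) (by rw [real_inner_comm, inner_jump])]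
  rw [Measure.map_smul, Measure.map_map measurable_swap ((hm _).prodMk (hm _))]
  rfl

/-! ### Retention and separation probabilities -/

lemma measurable_act_right (x : S2) : Measurable fun g : O3 => act g x :=
  measurable_act.comp (measurable_id.prodMk measurable_const)

lemma measurable_act_left (g : O3) : Measurable (act g) :=
  measurable_act.comp (measurable_const.prodMk measurable_id)

lemma IsAntipodalLawn.neg_mem_iff {L : Set S2} (hL : IsAntipodalLawn L) (x : S2) :
    -x ∈ L ↔ x ∉ L := by
  have := hL.mem_iff x; tauto

/-- The lawn seen after an orthogonal change of coordinates. -/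
lemma IsAntipodalLawn.preimage_act {L : Set S2} (hL : IsAntipodalLawn L) (g : O3) :
    IsAntipodalLawn (act g ⁻¹' L) :=
  ⟨measurable_act_left g hL.measurableSet, fun x => by
    rw [Set.mem_preimage, Set.mem_preimage, act_neg]; exact hL.mem_iff _⟩

lemma act_neg_one (x : S2) : act (-1) x = -x := rfl

lemma two_mul_area_lawn {L : Set S2} (hL : IsAntipodalLawn L) :
    2 * area.real L = area.real Set.univ := by
  have h1 : area.real Lᶜ = area.real L := by
    conv_rhs => rw [← area_map_act (-1), map_measureReal_apply (measurable_act_left _)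
      hL.measurableSet]
    congr 1
    ext x
    rw [Set.mem_preimage, act_neg_one, hL.neg_mem_iff]; rfl
  have h2 := measureReal_add_measureReal_compl (μ := area) hL.measurableSet
  linarith

/-- The pairs of points exactly one of which lies on `L`. -/
def separated (L : Set S2) : Set (S2 × S2) := {p | ¬(p.1 ∈ L ↔ p.2 ∈ L)}

lemma measurableSet_separated {L : Set S2} (hL : MeasurableSet L) :
    MeasurableSet (separated L) := by
  have h1 : MeasurableSet {p : S2 × S2 | p.1 ∈ L} := measurable_fst hL
  have h2 : MeasurableSet {p : S2 × S2 | p.2 ∈ L} := measurable_snd hL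
  have : separated L = symmDiff {p : S2 × S2 | p.1 ∈ L} {p : S2 × S2 | p.2 ∈ L} := by
    ext p
    simp only [separated, Set.mem_ofPred_eq, Set.mem_symmDiff]
    tauto
  rw [this]
  exact h1.symmDiff h2

lemma pairMeasure_real_univ (φ : ℝ) :
    (pairMeasure φ).real Set.univ = area.real Set.univ * (2 * π) := by
  rw [measureReal_def, pairMeasure_univ, ENNReal.toReal_mul,
    ENNReal.toReal_ofReal two_pi_pos.le, measureReal_def]

lemma pairMeasure_real_univ_pos (φ : ℝ) : 0 < (pairMeasure φ).real Set.univ := by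
  rw [pairMeasure_real_univ]
  have : 0 < area.real Set.univ :=
    ENNReal.toReal_pos area_univ_ne_zero (measure_ne_top _ _)
  have := pi_pos
  positivity

/-- The antipodal map preserves the pair law and exchanges `L ×ˢ L` with `Lᶜ ×ˢ Lᶜ`, so these two
halves of the non-separated pairs have equal mass. -/
lemma two_mul_pairMeasure_prod {L : Set S2} (hL : IsAntipodalLawn L) (φ : ℝ) :
    2 * (pairMeasure φ).real (L ×ˢ L) =
      (pairMeasure φ).real Set.univ - (pairMeasure φ).real (separated L) := by
  have h1 : (pairMeasure φ).real (Lᶜ ×ˢ Lᶜ) = (pairMeasure φ).real (L ×ˢ L) := by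
    have hm : Measurable fun p : S2 × S2 => (act (-1) p.1, act (-1) p.2) :=
      ((measurable_act_left _).comp measurable_fst).prodMk
        ((measurable_act_left _).comp measurable_snd)
    conv_rhs => rw [← pairMeasure_map_act φ (-1), map_measureReal_apply hm
      (hL.measurableSet.prod hL.measurableSet)]
    congr 1
    ext p
    simp [act_neg_one, hL.neg_mem_iff]
  have h2 : separated L = (L ×ˢ L ∪ Lᶜ ×ˢ Lᶜ)ᶜ := by
    ext p
    simp only [separated, Set.mem_ofPred_eq, Set.mem_compl_iff, Set.mem_union, Set.mem_prod]
    tauto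
  have hm := hL.measurableSet.prod hL.measurableSet
  have hm' := hL.measurableSet.compl.prod hL.measurableSet.compl
  have hd : Disjoint (L ×ˢ L) (Lᶜ ×ˢ Lᶜ) := by
    rw [Set.disjoint_left]
    rintro p ⟨h, -⟩ ⟨h', -⟩
    exact h' h
  have h3 := measureReal_add_measureReal_compl (μ := pairMeasure φ) (hm.union hm')
  rw [← h2, measureReal_union hd hm', h1] at h3
  linarith

lemma retentionProb_eq {L : Set S2} (hL : IsAntipodalLawn L) (φ : ℝ) :
    retentionProb φ L =
      1 - (pairMeasure φ).real (separated L) / (pairMeasure φ).real Set.univ := by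
  have hT := pairMeasure_real_univ_pos φ
  have h1 := two_mul_pairMeasure_prod hL φ
  have h2 : retentionProb φ L = (area.real L)⁻¹ * (2 * π)⁻¹ * (pairMeasure φ).real (L ×ˢ L) := by
    have hms : MeasurableSet {p : S2 × ℝ | jump φ p.1 p.2 ∈ L} :=
      measurable_jump φ hL.measurableSet
    have hs : (L ×ˢ Set.Ico 0 (2 * π)) ∩ {p : S2 × ℝ | jump φ p.1 p.2 ∈ L} =
        (fun p : S2 × ℝ => (p.1, jump φ p.1 p.2)) ⁻¹' (L ×ˢ L) ∩
          (Set.univ ×ˢ Set.Ico 0 (2 * π)) := by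
      ext p
      simp only [Set.mem_inter_iff, Set.mem_prod, Set.mem_ofPred_eq, Set.mem_preimage,
        Set.mem_univ, true_and]
      tauto
    rw [retentionProb, ProbabilityTheory.cond, ProbabilityTheory.cond,
      Measure.prod_smul_left, Measure.prod_smul_right,
      measureReal_def, Measure.smul_apply, Measure.smul_apply, smul_eq_mul, smul_eq_mul,
      ENNReal.toReal_mul, ENNReal.toReal_mul, Measure.prod_restrict,
      Measure.restrict_apply hms, Set.inter_comm, hs, pairMeasure,
      map_measureReal_apply (measurable_pair φ) (hL.measurableSet.prod hL.measurableSet),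
      measureReal_def, measureReal_def, ← Measure.restrict_univ (μ := area), Measure.prod_restrict,
      Measure.restrict_apply (measurable_pair φ (hL.measurableSet.prod hL.measurableSet))]
    simp [pi_pos.le]
    ring
  rw [h2]
  have h3 := two_mul_area_lawn hL
  have h4 := pairMeasure_real_univ φ
  have hA : area.real L ≠ 0 := by
    intro h
    rw [h, mul_zero] at h3
    rw [h4, ← h3] at hT
    simp at hT
  rw [← h3] at h4
  have hpi := pi_ne_zero
  field_simp
  rw [h4] at h1 ⊢
  linear_combination (2 * π * area.real L) * h1

lemma retentionProb_le_iff {L L' : Set S2} (hL : IsAntipodalLawn L) (hL' : IsAntipodalLawn L')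
    (φ : ℝ) : retentionProb φ L ≤ retentionProb φ L' ↔
      (pairMeasure φ).real (separated L') ≤ (pairMeasure φ).real (separated L) := by
  rw [retentionProb_eq hL, retentionProb_eq hL', sub_le_sub_iff_left,
    div_le_div_iff_of_pos_right (pairMeasure_real_univ_pos φ)]

lemma pairMeasure_separated_preimage_act {L : Set S2} (hL : MeasurableSet L) (φ : ℝ) (g : O3) :
    (pairMeasure φ).real (separated (act g ⁻¹' L)) = (pairMeasure φ).real (separated L) := by
  have hm : Measurable fun p : S2 × S2 => (act g p.1, act g p.2) :=
    ((measurable_act_left _).comp measurable_fst).prodMk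
      ((measurable_act_left _).comp measurable_snd)
  conv_rhs => rw [← pairMeasure_map_act φ g, map_measureReal_apply hm (measurableSet_separated hL)]
  rfl

/-- One random `g` now serves all pairs `a, b` at angle `φ` simultaneously, which makes the events
of a whole chain of jumps comparable. -/
lemma pairMeasure_separated_eq {L : Set S2} (hL : MeasurableSet L) {φ : ℝ} (hφ : sin φ ≠ 0)
    {a b : S2} (hab : inner ℝ a.1 b.1 = cos φ) :
    (pairMeasure φ).real (separated L) = (pairMeasure φ).real Set.univ *
      haarO3.real {g | ¬(act g a ∈ L ↔ act g b ∈ L)} := by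
  conv_lhs => rw [pairMeasure_eq_map_haarO3 hφ hab]
  rw [measureReal_def, Measure.smul_apply, smul_eq_mul, ENNReal.toReal_mul,
    Measure.map_apply ((measurable_act_right a).prodMk (measurable_act_right b))
      (measurableSet_separated hL)]
  rfl

lemma area_equator (n : S2) : area {x | inner ℝ n.1 x.1 = 0} = 0 := by
  have hm : MeasurableSet {x : S2 | inner ℝ n.1 x.1 = 0} :=
    measurableSet_eq_fun (Continuous.measurable (by fun_prop)) measurable_const
  rw [area, Measure.toSphere_apply' _ hm]
  have h0 : (volume : Measure E3) ((LinearMap.ker (innerₛₗ ℝ n.1) : Submodule ℝ E3) : Set E3) = 0 := by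
    refine Measure.addHaar_submodule _ _ fun h => ?_
    have : n.1 ∈ LinearMap.ker (innerₛₗ ℝ n.1) := by rw [h]; trivial
    simp at this
  rw [measure_mono_null _ h0, mul_zero]
  rintro _ ⟨c, hc, _, ⟨x, hx, rfl⟩, rfl⟩
  simp only [SetLike.mem_coe, LinearMap.mem_ker]
  change inner ℝ n.1 (c • x.1) = 0
  rw [inner_smul_right, hx, mul_zero]

/-- The law of `act g a` is a multiple of the area, being a marginal of the pair law up to a factor.
The jump size `π / 2` is an arbitrary choice with nonzero sine. -/
lemma haarO3_act_equator (n a : S2) : haarO3 {g | inner ℝ n.1 (act g a).1 = 0} = 0 := by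
  have hm : MeasurableSet {x : S2 | inner ℝ n.1 x.1 = 0} :=
    measurableSet_eq_fun (Continuous.measurable (by fun_prop)) measurable_const
  have hs : sin (π / 2) ≠ 0 := by simp
  have h1 := pairMeasure_eq_map_haarO3 hs (inner_jump (π / 2) a 0)
  have h2 : pairMeasure (π / 2) ({x : S2 | inner ℝ n.1 x.1 = 0} ×ˢ Set.univ) = 0 := by
    rw [pairMeasure, Measure.map_apply (measurable_pair _) (hm.prod MeasurableSet.univ)]
    refine measure_mono_null (t := {x : S2 | inner ℝ n.1 x.1 = 0} ×ˢ Set.univ) ?_ ?_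
    · rintro p ⟨h, -⟩
      exact ⟨h, trivial⟩
    · rw [Measure.prod_prod, area_equator, zero_mul]
  rw [h1, Measure.smul_apply, smul_eq_mul, mul_eq_zero, Measure.map_apply
    ((measurable_act_right _).prodMk (measurable_act_right _)) (hm.prod MeasurableSet.univ)] at h2
  rcases h2 with h2 | h2
  · have := pairMeasure_real_univ_pos (π / 2)
    rw [measureReal_def, h2] at this
    simp at this
  · refine measure_mono_null ?_ h2
    exact fun g hg => ⟨hg, trivial⟩

lemma IsAntipodalLawn.mem_iff_of_pole {H : Set S2} (hH : IsAntipodalLawn H) {n : S2}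
    (hn : {x : S2 | 0 < inner ℝ n.1 x.1} ⊆ H) {x : S2} (hx : inner ℝ n.1 x.1 ≠ 0) :
    x ∈ H ↔ 0 < inner ℝ n.1 x.1 := by
  refine ⟨fun h => ?_, fun h => hn h⟩
  by_contra hc
  have : 0 < inner ℝ n.1 (-x).1 := by
    change 0 < inner ℝ n.1 (-x.1)
    rw [inner_neg_right]
    rcases lt_or_gt_of_ne hx with h' | h'
    · linarith
    · exact absurd h' hc
  exact (hH.neg_mem_iff x).mp (hn this) h

/-! ### Optimality for jumps of size `π / q` -/

/-- The point of the horizontal great circle at angle `θ`. -/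
noncomputable def circ (θ : ℝ) : S2 :=
  ⟨!₂[cos θ, sin θ, 0], by simp [EuclideanSpace.norm_eq, Fin.sum_univ_three]⟩

lemma inner_circ (θ θ' : ℝ) : inner ℝ (circ θ).1 (circ θ').1 = cos (θ' - θ) := by
  rw [inner_eq_sum, cos_sub]; simp [circ]; ring

lemma circ_add_pi (θ : ℝ) : circ (θ + π) = -circ θ := by
  refine Subtype.ext ?_
  ext i
  fin_cases i <;> simp [circ]

lemma circ_eq (θ : ℝ) : (circ θ).1 = cos θ • (circ 0).1 + sin θ • (circ (π / 2)).1 := by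
  ext i
  fin_cases i <;> simp [circ]

/-- If no step changed membership, the two ends of the chain would agree; but they are antipodal. -/
lemma separated_chain {L : Set S2} (hL : IsAntipodalLawn L) {q : ℕ} (hq : q ≠ 0) (g : O3) :
    ∃ i ∈ Finset.range q, ¬(act g (circ (i * (π / q))) ∈ L ↔
      act g (circ ((i + 1 : ℕ) * (π / q))) ∈ L) := by
  by_contra! hc
  have h : ∀ i ≤ q, (act g (circ 0) ∈ L ↔ act g (circ (i * (π / q))) ∈ L) := by
    intro i
    induction i with
    | zero => simp
    | succ i ih =>
      intro hi
      rw [ih (by omega)]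
      exact hc i (Finset.mem_range.mpr hi)
  have h' := h q le_rfl
  rw [mul_div_cancel₀ _ (by exact_mod_cast hq : (q : ℝ) ≠ 0), ← zero_add π, circ_add_pi, act_neg,
    hL.neg_mem_iff] at h'
  tauto

lemma measurableSet_act_separated {L : Set S2} (hL : MeasurableSet L) (a b : S2) :
    MeasurableSet {g : O3 | ¬(act g a ∈ L ↔ act g b ∈ L)} :=
  ((measurable_act_right a).prodMk (measurable_act_right b)) (measurableSet_separated hL)

lemma sin_pi_div_ne_zero {q : ℕ} (hq : 1 < q) : sin (π / q) ≠ 0 := by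
  have h1 : (1 : ℝ) < q := by exact_mod_cast hq
  exact (sin_pos_of_pos_of_lt_pi (by have := pi_pos; positivity)
    (div_lt_self pi_pos h1)).ne'

/-- Summed along a chain of `q` jumps of size `π / q` on a great circle, the separation
probabilities are all equal. -/
lemma sum_haarO3_separated {L : Set S2} (hL : MeasurableSet L) {q : ℕ} (hq : 1 < q) :
    (pairMeasure (π / q)).real Set.univ * ∑ i ∈ Finset.range q,
      haarO3.real {g | ¬(act g (circ (i * (π / q))) ∈ L ↔
        act g (circ ((i + 1 : ℕ) * (π / q))) ∈ L)} =
      q * (pairMeasure (π / q)).real (separated L) := by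
  rw [Finset.mul_sum, Finset.sum_congr rfl fun (i : ℕ) _ => (pairMeasure_separated_eq hL
    (sin_pi_div_ne_zero hq) (a := circ (i * (π / q))) (b := circ ((i + 1 : ℕ) * (π / q))) (by
      rw [inner_circ]; congr 1; push_cast; ring)).symm]
  simp

lemma one_le_sum_haarO3_separated {L : Set S2} (hL : IsAntipodalLawn L) {q : ℕ} (hq : q ≠ 0) :
    1 ≤ ∑ i ∈ Finset.range q, haarO3.real {g | ¬(act g (circ (i * (π / q))) ∈ L ↔
        act g (circ ((i + 1 : ℕ) * (π / q))) ∈ L)} := by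
  refine le_trans ?_ (measureReal_biUnion_finset_le _ _)
  rw [show (⋃ i ∈ Finset.range q, {g : O3 | ¬(act g (circ (i * (π / q))) ∈ L ↔
        act g (circ ((i + 1 : ℕ) * (π / q))) ∈ L)}) = Set.univ from ?_]
  · simp
  · refine Set.eq_univ_of_forall fun g => ?_
    obtain ⟨i, hi, h⟩ := separated_chain hL hq g
    exact Set.mem_biUnion hi h

lemma exists_zero_of_sign_change {f : ℝ → ℝ} (hf : Continuous f) {a b : ℝ} (hab : a ≤ b)
    (ha : f a ≠ 0) (hb : f b ≠ 0) (h : ¬(0 < f a ↔ 0 < f b)) :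
    ∃ t, a < t ∧ t < b ∧ f t = 0 := by
  have h0 : (0 : ℝ) ∈ f '' Set.uIcc a b := by
    apply intermediate_value_uIcc hf.continuousOn
    rw [Set.mem_uIcc]
    rcases lt_or_gt_of_ne ha with h1 | h1 <;> rcases lt_or_gt_of_ne hb with h2 | h2
    · exact absurd (iff_of_false h1.not_gt h2.not_gt) h
    · exact Or.inl ⟨h1.le, h2.le⟩
    · exact Or.inr ⟨h2.le, h1.le⟩
    · exact absurd (iff_of_true h1 h2) h
  obtain ⟨t, ht, h0⟩ := h0
  rw [Set.uIcc_of_le hab] at ht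
  refine ⟨t, lt_of_le_of_ne ht.1 ?_, lt_of_le_of_ne ht.2 ?_, h0⟩
  · rintro rfl; exact ha h0
  · rintro rfl; exact hb h0

/-- Along a great circle the height over the boundary plane is `A cos t + B sin t`. Unless it
vanishes identically, it has at most one zero strictly inside a half turn, so almost surely at most
one step separates. The events are therefore almost disjoint and their probabilities add up to at
most one. -/
lemma sum_haarO3_separated_hemisphere_le {H : Set S2} (hH : IsHemisphericalLawn H) {q : ℕ}
    (hq : q ≠ 0) :
    ∑ i ∈ Finset.range q, haarO3.real {g | ¬(act g (circ (i * (π / q))) ∈ H ↔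
        act g (circ ((i + 1 : ℕ) * (π / q))) ∈ H)} ≤ 1 := by
  obtain ⟨n, hn⟩ := hH.exists_pole
  have hq0 : (q : ℝ) ≠ 0 := by exact_mod_cast hq
  have hq1 : (0 : ℝ) < q := by positivity
  set A : ℕ → Set O3 := fun i => {g | ¬(act g (circ (i * (π / q))) ∈ H ↔
        act g (circ ((i + 1 : ℕ) * (π / q))) ∈ H)} with hA
  have hmem : ∀ (i : ℕ) (g : O3), inner ℝ n.1 (act g (circ (i * (π / q)))).1 ≠ 0 →
      inner ℝ n.1 (act g (circ ((i + 1 : ℕ) * (π / q)))).1 ≠ 0 → g ∈ A i →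
      ∃ t, i * (π / q) < t ∧ t < (i + 1 : ℕ) * (π / q) ∧ inner ℝ n.1 (act g (circ t)).1 = 0 := by
    intro i g h1 h2 h
    refine exists_zero_of_sign_change (f := fun t => inner ℝ n.1 (act g (circ t)).1) ?_ ?_ h1 h2 ?_
    · have : (fun t => inner ℝ n.1 (act g (circ t)).1) = fun t =>
          cos t * inner ℝ n.1 (g.1 (circ 0).1) + sin t * inner ℝ n.1 (g.1 (circ (π / 2)).1) := by
        funext t
        rw [coe_act, circ_eq, map_add, map_smul, map_smul, inner_add_right, inner_smul_right,
          inner_smul_right]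
      rw [this]
      fun_prop
    · have := pi_pos
      push_cast
      gcongr
      linarith
    · rw [hA, Set.mem_ofPred_eq, hH.mem_iff_of_pole hn h1, hH.mem_iff_of_pole hn h2] at h
      exact h
  have hdis : ∀ i j, i < j → j < q → haarO3 (A i ∩ A j) = 0 := by
    intro i j hij hj
    -- Discarding the null set on which a vertex of the chain hits the boundary circle, so that
    -- every separating step has a zero in its interior.
    have hz : haarO3 (⋃ k : ℕ, {g | inner ℝ n.1 (act g (circ (k * (π / q)))).1 = 0}) = 0 :=
      measure_iUnion_null fun k => haarO3_act_equator n _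
    refine measure_mono_null (fun g hg => ?_) hz
    by_contra hc
    have hc' : ∀ k : ℕ, inner ℝ n.1 (act g (circ (k * (π / q)))).1 ≠ 0 := by
      simpa using hc
    obtain ⟨s, hs1, hs2, hs⟩ := hmem i g (hc' _) (hc' _) hg.1
    obtain ⟨t, ht1, ht2, ht⟩ := hmem j g (hc' _) (hc' _) hg.2
    have hp : 0 < π / q := div_pos pi_pos hq1
    have hst : s < t := by
      refine hs2.trans_le (le_trans ?_ ht1.le)
      gcongr
      omega
    have hts : t - s < π := by
      have h1 : t < π := by
        refine ht2.trans_le ?_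
        calc ((j + 1 : ℕ) : ℝ) * (π / q) ≤ q * (π / q) := by gcongr; omega
          _ = π := by field_simp
      have h2 : 0 ≤ i * (π / q) := by positivity
      linarith
    have hsin : 0 < sin (t - s) := sin_pos_of_pos_of_lt_pi (by linarith) hts
    have h0 := hc' 0
    rw [coe_act, circ_eq s, map_add, map_smul, map_smul, inner_add_right, inner_smul_right,
      inner_smul_right] at hs
    rw [coe_act, circ_eq t, map_add, map_smul, map_smul, inner_add_right, inner_smul_right,
      inner_smul_right] at ht
    rw [coe_act] at h0
    simp only [Nat.cast_zero, zero_mul] at h0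
    apply h0
    -- Eliminating `B` from the two equations `A cos + B sin = 0` at `s` and `t` leaves `A sin (t -
    -- s) = 0`, whereas `A`, the height at the vertex `0`, is nonzero.
    have : sin (t - s) * inner ℝ n.1 (g.1 (circ 0).1) = 0 := by
      rw [sin_sub]; linear_combination sin t * hs - sin s * ht
    exact (mul_eq_zero.mp this).resolve_left hsin.ne'
  rw [← measureReal_biUnion_finset₀]
  · exact measureReal_le_one
  · intro i hi j hj hij
    rcases lt_or_gt_of_ne hij with h | h
    · exact hdis i j h (Finset.mem_range.mp hj)
    · change haarO3 (A i ∩ A j) = 0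
      rw [Set.inter_comm]
      exact hdis j i h (Finset.mem_range.mp hi)
  · exact fun i _ => (measurableSet_act_separated hH.measurableSet _ _).nullMeasurableSet

/-- For jumps of size `π / q`, hemispherical lawns are optimal. -/
theorem retentionProb_le_hemisphere {q : ℕ} (hq : 1 < q) {L H : Set S2} (hL : IsAntipodalLawn L)
    (hH : IsHemisphericalLawn H) : retentionProb (π / q) L ≤ retentionProb (π / q) H := by
  rw [retentionProb_le_iff hL hH.toIsAntipodalLawn]
  have h1 := sum_haarO3_separated hL.measurableSet hq
  have h2 := sum_haarO3_separated hH.measurableSet hq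
  have h3 := one_le_sum_haarO3_separated hL (q := q) (by omega)
  have h4 := sum_haarO3_separated_hemisphere_le hH (q := q) (by omega)
  have hT := pairMeasure_real_univ_pos (π / q)
  have hq1 : (0 : ℝ) < q := by exact_mod_cast (by omega : 0 < q)
  refine le_of_mul_le_mul_left ?_ hq1
  rw [← h1, ← h2]
  exact mul_le_mul_of_nonneg_left (h4.trans h3) hT.le

/-! ### The area measure in longitude and slope -/

lemma lintegral_comp_mul_left {r : ℝ} (hr : 0 < r) {f : ℝ → ENNReal} (hf : Measurable f) :
    ∫⁻ z, f z = ENNReal.ofReal r * ∫⁻ u, f (r * u) := by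
  conv_lhs => rw [← Real.smul_map_volume_mul_left hr.ne']
  rw [lintegral_smul_measure, lintegral_map hf (measurable_const_mul r), abs_of_pos hr,
    smul_eq_mul]

lemma measurable_vec3 : Measurable fun p : ℝ × ℝ × ℝ => (!₂[p.1, p.2.1, p.2.2] : E3) := by
  refine (WithLp.measurable_toLp 2 _).comp (measurable_pi_lambda _ fun i => ?_)
  fin_cases i
  · exact measurable_fst
  · exact measurable_fst.comp measurable_snd
  · exact measurable_snd.comp measurable_snd

lemma lintegral_E3 {f : E3 → ENNReal} (hf : Measurable f) :
    ∫⁻ v, f v = ∫⁻ p : ℝ × ℝ, ∫⁻ z, f !₂[p.1, p.2, z] := by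
  set e := (MeasurableEquiv.piFinSuccAbove (fun _ : Fin 3 => ℝ) 2).symm with he
  have hf' : Measurable fun q : ℝ × (Fin 2 → ℝ) => f (WithLp.toLp 2 (e q)) :=
    hf.comp ((WithLp.measurable_toLp 2 _).comp e.measurable)
  have hp := (volume_preserving_piFinSuccAbove (fun _ : Fin 3 => ℝ) 2).symm
  rw [← (PiLp.volume_preserving_toLp (Fin 3)).lintegral_comp hf,
    ← hp.lintegral_comp (f := fun w => f (WithLp.toLp 2 w))
      (hf.comp (WithLp.measurable_toLp 2 _)), Measure.volume_eq_prod,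
    lintegral_prod_symm _ hf'.aemeasurable,
    ← (volume_preserving_finTwoArrow ℝ).symm.lintegral_comp hf'.lintegral_prod_left']
  refine lintegral_congr fun p => lintegral_congr fun z => ?_
  congr 2
  ext i
  fin_cases i <;> rfl

/-- Integration in the coordinates given by the longitude, the slope over the horizontal
plane, and the horizontal radius. -/
lemma lintegral_E3_cylindrical {f : E3 → ENNReal} (hf : Measurable f) :
    ∫⁻ v, f v = ∫⁻ l in Set.Ioo (-π) π, ∫⁻ u, ∫⁻ r in Set.Ioi (0 : ℝ),
      ENNReal.ofReal (r ^ 2) * f !₂[r * cos l, r * sin l, r * u] := by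
  have hm : Measurable fun q : (ℝ × ℝ) × ℝ =>
      ENNReal.ofReal (q.2 ^ 2) * f !₂[q.2 * cos q.1.1, q.2 * sin q.1.1, q.2 * q.1.2] := by
    refine Measurable.mul (by fun_prop) (hf.comp (measurable_vec3.comp
      (f := fun q : (ℝ × ℝ) × ℝ => (q.2 * cos q.1.1, q.2 * sin q.1.1, q.2 * q.1.2)) ?_))
    fun_prop
  rw [lintegral_E3 hf, ← lintegral_comp_polarCoord_symm, polarCoord_target,
    Measure.volume_eq_prod, ← Measure.prod_restrict, lintegral_prod_symm]
  · refine lintegral_congr fun l => ?_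
    -- One factor `r` is the polar Jacobian, the other comes from the substitution `z = r * u`.
    have h1 : ∀ r ∈ Set.Ioi (0 : ℝ), ENNReal.ofReal r •
        ∫⁻ z, f !₂[r * cos l, r * sin l, z] = ∫⁻ u,
          ENNReal.ofReal (r ^ 2) * f !₂[r * cos l, r * sin l, r * u] := by
      intro r hr
      rw [lintegral_comp_mul_left (Set.mem_Ioi.mp hr), lintegral_const_mul, smul_eq_mul,
        ← mul_assoc, ← ENNReal.ofReal_mul (Set.mem_Ioi.mp hr).le, sq]
      · exact hf.comp (measurable_vec3.comp
          (measurable_const.prodMk (measurable_const.prodMk (measurable_const_mul r))))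
      · exact hf.comp (measurable_vec3.comp
          (measurable_const.prodMk (measurable_const.prodMk measurable_id)))
    simp only [polarCoord_symm_apply]
    rw [setLIntegral_congr_fun measurableSet_Ioi h1, lintegral_lintegral_swap]
    refine Measurable.aemeasurable ?_
    exact hm.comp (f := fun q : ℝ × ℝ => ((l, q.2), q.1)) (by fun_prop)
  · refine Measurable.aemeasurable ?_
    have hm' : Measurable fun q : (ℝ × ℝ) × ℝ => f !₂[q.1.1, q.1.2, q.2] :=
      hf.comp (measurable_vec3.comp (f := fun q : (ℝ × ℝ) × ℝ => (q.1.1, q.1.2, q.2))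
        (by fun_prop))
    have h2 : Measurable fun p : ℝ × ℝ => ∫⁻ z, f !₂[p.1, p.2, z] := hm'.lintegral_prod_right'
    simp only [polarCoord_symm_apply]
    exact Measurable.smul (ENNReal.measurable_ofReal.comp measurable_fst)
      (h2.comp (f := fun p : ℝ × ℝ => (p.1 * cos p.2, p.1 * sin p.2)) (by fun_prop))

/-- The point of the sphere of longitude `l` and slope `u` over the horizontal plane. -/
noncomputable def pt (l u : ℝ) : S2 :=
  ⟨(√(1 + u ^ 2))⁻¹ • !₂[cos l, sin l, u], by
    have h : 0 < 1 + u ^ 2 := by positivity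
    rw [mem_sphere_zero_iff_norm, norm_smul, EuclideanSpace.norm_eq, Fin.sum_univ_three]
    simp
    rw [abs_of_pos (Real.sqrt_pos.mpr h), inv_mul_cancel₀ (Real.sqrt_pos.mpr h).ne']⟩

lemma measurable_pt : Measurable fun p : ℝ × ℝ => pt p.1 p.2 := by
  refine Measurable.subtype_mk (Measurable.smul
    (f := fun p : ℝ × ℝ => (√(1 + p.2 ^ 2))⁻¹) (by fun_prop) ?_)
  exact measurable_vec3.comp (f := fun p : ℝ × ℝ => (cos p.1, sin p.1, p.2)) (by fun_prop)

lemma mem_Ioo_smul_iff (S : Set S2) {r : ℝ} (hr : 0 < r) (l u : ℝ) :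
    (!₂[r * cos l, r * sin l, r * u] : E3) ∈ Set.Ioo (0 : ℝ) 1 • (Subtype.val '' S) ↔
      r < (√(1 + u ^ 2))⁻¹ ∧ pt l u ∈ S := by
  have h : 0 < √(1 + u ^ 2) := Real.sqrt_pos.mpr (by positivity)
  have hv : (!₂[r * cos l, r * sin l, r * u] : E3) = (r * √(1 + u ^ 2)) • (pt l u).1 := by
    change _ = (r * √(1 + u ^ 2)) • (√(1 + u ^ 2))⁻¹ • !₂[cos l, sin l, u]
    rw [smul_smul, mul_assoc, mul_inv_cancel₀ h.ne', mul_one]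
    ext i
    fin_cases i <;> simp
  rw [hv, lt_inv_comm₀ hr h, ← one_div, lt_div_iff₀' hr]
  constructor
  · rintro ⟨c, hc, _, ⟨x, hx, rfl⟩, hcx⟩
    change c • x.1 = _ at hcx
    have hn := congrArg norm hcx
    rw [norm_smul, norm_smul, norm_eq_of_mem_sphere, norm_eq_of_mem_sphere, mul_one, mul_one,
      Real.norm_of_nonneg hc.1.le, Real.norm_of_nonneg (by positivity)] at hn
    rw [← hn] at hcx ⊢
    refine ⟨hc.2, ?_⟩
    have : x = pt l u := Subtype.ext (smul_right_injective _ hc.1.ne' hcx)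
    rwa [← this]
  · rintro ⟨h1, h2⟩
    exact ⟨_, ⟨by positivity, h1⟩, _, ⟨_, h2, rfl⟩, rfl⟩

lemma setLIntegral_Ioi_sq {a : ℝ} (ha : 0 ≤ a) :
    ∫⁻ r in Set.Ioi (0 : ℝ), ENNReal.ofReal (r ^ 2) * (Set.Iio a).indicator 1 r =
      ENNReal.ofReal (a ^ 3 / 3) := by
  have h1 : ∀ r : ℝ, ENNReal.ofReal (r ^ 2) * (Set.Iio a).indicator 1 r =
      (Set.Iio a).indicator (fun r => ENNReal.ofReal (r ^ 2)) r := by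
    intro r
    by_cases hr : r ∈ Set.Iio a <;> simp [hr]
  simp only [h1]
  rw [lintegral_indicator measurableSet_Iio, Measure.restrict_restrict measurableSet_Iio,
    Set.Iio_inter_Ioi, Measure.restrict_congr_set Ioo_ae_eq_Ioc,
    ← ofReal_integral_eq_lintegral_ofReal (intervalIntegral.intervalIntegrable_pow _).1,
    ← intervalIntegral.integral_of_le ha, integral_pow]
  · norm_num
  · exact Filter.Eventually.of_forall fun r => sq_nonneg r

/-- The density of the area measure in the coordinates of `pt`. -/
noncomputable def dens (u : ℝ) : ℝ := (√(1 + u ^ 2))⁻¹ ^ 3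

lemma continuous_dens : Continuous dens := by
  unfold dens
  refine Continuous.pow (Continuous.inv₀ (by fun_prop) fun u => ?_) 3
  exact (Real.sqrt_pos.mpr (by positivity)).ne'

lemma dens_nonneg (u : ℝ) : 0 ≤ dens u := by unfold dens; positivity

lemma dens_le_one (u : ℝ) : dens u ≤ 1 := by
  refine pow_le_one₀ (by positivity) (inv_le_one_of_one_le₀ ?_)
  rw [Real.one_le_sqrt]
  nlinarith [sq_nonneg u]

lemma dens_zero : dens 0 = 1 := by simp [dens]

/-- The area measure in the coordinates of `pt`. -/
theorem area_eq_map_pt :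
    area = (((volume : Measure ℝ).restrict (Set.Ioo (-π) π)).prod
      ((volume : Measure ℝ).withDensity fun u => ENNReal.ofReal (dens u))).map
        fun p => pt p.1 p.2 := by
  have hd : Measurable fun u => ENNReal.ofReal (dens u) := by
    have := continuous_dens.measurable
    fun_prop
  ext S hS
  classical
  have hC : MeasurableSet (Set.Ioo (0 : ℝ) 1 • (Subtype.val '' S) : Set E3) := by
    have : (Set.Ioo (0 : ℝ) 1 • (Subtype.val '' S) : Set E3) = Subtype.val ''
        (homeomorphUnitSphereProd E3 ⁻¹' (S ×ˢ Set.Iio ⟨1, Set.mem_Ioi.mpr one_pos⟩)) := by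
      rw [show Set.Ioo (0 : ℝ) 1 = Subtype.val ''
          Set.Iio (⟨1, Set.mem_Ioi.mpr one_pos⟩ : Set.Ioi (0 : ℝ)) from
        (Set.image_subtype_val_Ioi_Iio (⟨1, Set.mem_Ioi.mpr one_pos⟩ :
          Set.Ioi (0 : ℝ))).symm,
        ← Set.image2_smul, Set.image2_image_right, ← Homeomorph.image_symm, Set.image_image,
        Set.image2_image_left, Set.image2_swap, ← Set.image_prod]
      rfl
    rw [this]
    exact (measurableSet_singleton _).compl.subtype_image
      ((homeomorphUnitSphereProd E3).continuous.measurable (hS.prod measurableSet_Iio))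
  rw [Measure.map_apply measurable_pt hS, Measure.prod_apply (measurable_pt hS), area,
    Measure.toSphere_apply' _ hS, ← lintegral_indicator_one hC,
    lintegral_E3_cylindrical (measurable_one.indicator hC)]
  -- On the ray of slope `u` the unit ball ends at horizontal radius `(1 + u ^ 2) ^ (-1 / 2)`, so
  -- the radial integral is `dens u / 3`. The dimension factor `3` in `Measure.toSphere` cancels the
  -- denominator.
  have h1 : ∀ l u : ℝ, ∫⁻ r in Set.Ioi (0 : ℝ), ENNReal.ofReal (r ^ 2) *
      (Set.Ioo (0 : ℝ) 1 • (Subtype.val '' S) : Set E3).indicator 1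
        !₂[r * cos l, r * sin l, r * u] =
      ENNReal.ofReal (dens u / 3) *
        (Prod.mk l ⁻¹' ((fun p : ℝ × ℝ => pt p.1 p.2) ⁻¹' S)).indicator 1 u := by
    classical
    intro l u
    by_cases hpt : pt l u ∈ S
    · rw [Set.indicator_of_mem (by exact hpt), Pi.one_apply, mul_one, dens,
        ← setLIntegral_Ioi_sq (by positivity)]
      refine setLIntegral_congr_fun measurableSet_Ioi fun r hr => ?_
      simp only [Set.indicator_apply, mem_Ioo_smul_iff S (Set.mem_Ioi.mp hr), hpt, and_true,
        Set.mem_Iio, Pi.one_apply]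
    · rw [Set.indicator_of_notMem (by exact hpt), mul_zero]
      rw [setLIntegral_congr_fun (g := fun _ => 0) measurableSet_Ioi fun r hr => ?_, lintegral_zero]
      simp [mem_Ioo_smul_iff S (Set.mem_Ioi.mp hr), hpt]
  simp only [h1]
  rw [← lintegral_const_mul']
  · refine lintegral_congr fun l => ?_
    have hml : MeasurableSet (Prod.mk l ⁻¹' ((fun p : ℝ × ℝ => pt p.1 p.2) ⁻¹' S)) :=
      measurable_prodMk_left (measurable_pt hS)
    rw [withDensity_apply _ hml, ← lintegral_indicator hml, ← lintegral_const_mul']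
    · refine lintegral_congr fun u => ?_
      rw [Set.indicator_apply, Set.indicator_apply]
      split_ifs
      · rw [Pi.one_apply, mul_one, finrank_euclideanSpace, Fintype.card_fin, Nat.cast_ofNat,
          show (3 : ENNReal) = ENNReal.ofReal 3 by simp, ← ENNReal.ofReal_mul (by norm_num)]
        congr 1; ring
      · simp
    · simp
  · simp

/-! ### Integrals of step functions -/

lemma integral_step {f g : ℝ → ℝ} (hg : Continuous g) {p a q : ℝ} (hpa : p ≤ a) (haq : a ≤ q)
    (h1 : ∀ x ∈ Set.Ioo p a, f x = -g x) (h2 : ∀ x ∈ Set.Ioo a q, f x = g x) :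
    IntervalIntegrable f volume p q ∧
      ∫ x in p..q, f x = (∫ x in a..q, g x) - ∫ x in p..a, g x := by
  have e1 : IntervalIntegrable f volume p a :=
    (hg.neg.intervalIntegrable p a).congr_uIoo fun x hx => by
      rw [Set.uIoo_of_le hpa] at hx; exact (h1 x hx).symm
  have e2 : IntervalIntegrable f volume a q :=
    (hg.intervalIntegrable a q).congr_uIoo fun x hx => by
      rw [Set.uIoo_of_le haq] at hx; exact (h2 x hx).symm
  refine ⟨e1.trans e2, ?_⟩
  rw [← intervalIntegral.integral_add_adjacent_intervals e1 e2,
    intervalIntegral.integral_congr_uIoo (g := fun x => -g x) fun x hx => ?_,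
    intervalIntegral.integral_congr_uIoo (a := a) (g := g) fun x hx => ?_,
    intervalIntegral.integral_neg]
  · ring
  · rw [Set.uIoo_of_le haq] at hx; exact h2 x hx
  · rw [Set.uIoo_of_le hpa] at hx; exact h1 x hx

/-- The change of the sign of `v` when the threshold is raised from `0` to `h`. -/
noncomputable def signChange (v h : ℝ) : ℝ := Real.sign (v - h) - Real.sign v

lemma integral_mul_sign_sub {g : ℝ → ℝ} (hg : Continuous g) {p q h : ℝ} (hp : p ≤ h)
    (hq : h ≤ q) : IntervalIntegrable (fun v => Real.sign (v - h) * g v) volume p q ∧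
      ∫ v in p..q, Real.sign (v - h) * g v = (∫ x in h..q, g x) - ∫ x in p..h, g x :=
  integral_step hg hp hq
    (fun x hx => by rw [Real.sign_of_neg (sub_neg.mpr hx.2), neg_one_mul])
    (fun x hx => by rw [Real.sign_of_pos (sub_pos.mpr hx.1), one_mul])

/-- Up to the endpoints, `signChange v h` is supported between `0` and `h`, with value `-2` if `h >
0` and `2` if `h < 0`; the orientation of the integral absorbs the sign. -/
lemma integral_signChange_mul {g : ℝ → ℝ} (hg : Continuous g) {p q h : ℝ} (hp : p ≤ -1)
    (hq : 1 ≤ q) (hh : |h| ≤ 1) :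
    ∫ v in p..q, signChange v h * g v = -2 * ∫ x in 0..h, g x := by
  obtain ⟨hh1, hh2⟩ := abs_le.mp hh
  obtain ⟨i1, e1⟩ := integral_mul_sign_sub hg (hp.trans hh1) (hh2.trans hq)
  obtain ⟨i0, e0⟩ := integral_mul_sign_sub hg (h := 0) (hp.trans (by norm_num))
    (le_trans (by norm_num) hq)
  simp only [sub_zero] at i0 e0
  simp only [signChange, sub_mul]
  rw [intervalIntegral.integral_sub i1 i0, e1, e0]
  have hi : ∀ a b, IntervalIntegrable g volume a b := fun a b => hg.intervalIntegrable a b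
  have e2 := intervalIntegral.integral_add_adjacent_intervals (hi 0 h) (hi h q)
  have e3 := intervalIntegral.integral_add_adjacent_intervals (hi p 0) (hi 0 h)
  linarith

lemma integral_signChange {p q h : ℝ} (hp : p ≤ -1) (hq : 1 ≤ q) (hh : |h| ≤ 1) :
    ∫ v in p..q, signChange v h = -2 * h := by
  have := integral_signChange_mul (g := fun _ => 1) continuous_const hp hq hh
  simpa using this

lemma integral_signChange_affine {s c h M : ℝ} (hs : s ≠ 0) (hM : 1 + |c| ≤ |s| * M)
    (hh : |h| ≤ 1) : ∫ x in -M..M, signChange (c + s * x) h = -2 * h / |s| := by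
  have hc := abs_le.mp (le_refl |c|)
  rw [intervalIntegral.integral_comp_add_mul (fun v => signChange v h) hs, smul_eq_mul]
  rcases lt_or_gt_of_ne hs with h0 | h0
  · rw [abs_of_neg h0] at hM ⊢
    rw [intervalIntegral.integral_symm, integral_signChange (by linarith) (by linarith) hh]
    field_simp
  · rw [abs_of_pos h0] at hM ⊢
    rw [integral_signChange (by linarith) (by linarith) hh]
    field_simp

/-! ### Limits of integrals of bounded functions -/

lemma tendsto_intervalIntegral_of_bounded {F : ℝ → ℝ → ℝ} {f : ℝ → ℝ} {a b C : ℝ}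
    (hm : ∀ ε, Measurable (F ε))
    (hb : ∀ᶠ ε in 𝓝[>] 0, ∀ x ∈ Set.uIoc a b, |F ε x| ≤ C)
    (hl : ∀ᵐ x, x ∈ Set.uIoc a b → Tendsto (fun ε => F ε x) (𝓝[>] 0) (𝓝 (f x))) :
    Tendsto (fun ε => ∫ x in a..b, F ε x) (𝓝[>] 0) (𝓝 (∫ x in a..b, f x)) := by
  refine intervalIntegral.tendsto_integral_filter_of_dominated_convergence (fun _ => C)
    (Eventually.of_forall fun ε => (hm ε).aestronglyMeasurable) ?_ intervalIntegrable_const hl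
  filter_upwards [hb] with ε h
  exact Eventually.of_forall h

lemma abs_intervalIntegral_le {f : ℝ → ℝ} {a b C : ℝ} (h : ∀ x ∈ Set.uIoc a b, |f x| ≤ C) :
    |∫ x in a..b, f x| ≤ C * |b - a| := by
  simpa only [Real.norm_eq_abs] using intervalIntegral.norm_integral_le_of_norm_le_const
    (f := f) (C := C) (by simpa only [Real.norm_eq_abs] using h)

lemma measurable_intervalIntegral {α : Type*} [MeasurableSpace α] {f : α → ℝ → ℝ}
    (hf : Measurable fun p : α × ℝ => f p.1 p.2) (a b : ℝ) :
    Measurable fun x => ∫ t in a..b, f x t := by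
  simp only [intervalIntegral]
  exact (hf.stronglyMeasurable.integral_prod_right'.sub
    hf.stronglyMeasurable.integral_prod_right').measurable

lemma integral_area_eq {f : S2 → ℝ} (hf : Measurable f) {C : ℝ} (hC : ∀ x, |f x| ≤ C) :
    ∫ x, f x ∂area = ∫ l in -π..π, ∫ u, dens u * f (pt l u) := by
  have hd : Measurable fun u => ENNReal.ofReal (dens u) := by
    have := continuous_dens.measurable
    fun_prop
  set ν := ((volume : Measure ℝ).restrict (Set.Ioo (-π) π)).prod
      ((volume : Measure ℝ).withDensity fun u => ENNReal.ofReal (dens u)) with hν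
  have hfin : IsFiniteMeasure ν := by
    constructor
    have := measure_lt_top area Set.univ
    rwa [area_eq_map_pt, Measure.map_apply measurable_pt MeasurableSet.univ] at this
  have hi : Integrable (fun p : ℝ × ℝ => f (pt p.1 p.2)) ν :=
    Integrable.of_bound (hf.comp measurable_pt).aestronglyMeasurable C
      (Eventually.of_forall fun p => hC _)
  rw [area_eq_map_pt, integral_map measurable_pt.aemeasurable hf.aestronglyMeasurable,
    integral_prod _ hi, intervalIntegral.integral_of_le (by linarith [pi_pos]),
    integral_Ioc_eq_integral_Ioo]
  refine integral_congr_ae (Eventually.of_forall fun l => ?_)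
  simp only
  rw [integral_withDensity_eq_integral_toReal_smul hd (by simp)]
  refine integral_congr_ae (Eventually.of_forall fun u => ?_)
  simp only [ENNReal.toReal_ofReal (dens_nonneg u), smul_eq_mul]

/-! ### Jumps in coordinates -/

lemma tangentDir_pt (l u : ℝ) : tangentDir (pt l u) = !₂[-sin l, cos l, 0] := by
  set s := (√(1 + u ^ 2))⁻¹ with hs
  have hs0 : 0 < s := inv_pos.mpr (Real.sqrt_pos.mpr (by positivity))
  have h0 : (pt l u).1 0 = s * cos l := rfl
  have h1 : (pt l u).1 1 = s * sin l := rfl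
  have hne : ¬((pt l u).1 0 = 0 ∧ (pt l u).1 1 = 0) := by
    rw [h0, h1]
    rintro ⟨h2, h3⟩
    have h4 := Real.sin_sq_add_cos_sq l
    rw [(mul_eq_zero.mp h2).resolve_left hs0.ne', (mul_eq_zero.mp h3).resolve_left hs0.ne'] at h4
    norm_num at h4
  have hr : √((pt l u).1 0 ^ 2 + (pt l u).1 1 ^ 2) = s := by
    rw [h0, h1, show (s * cos l) ^ 2 + (s * sin l) ^ 2 = s ^ 2 by
      linear_combination s ^ 2 * Real.sin_sq_add_cos_sq l, Real.sqrt_sq hs0.le]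
  rw [tangentDir, if_neg hne, hr, h0, h1]
  ext i
  fin_cases i <;> simp [hs0.ne']

lemma pt_two (l u : ℝ) : (pt l u).1 2 = (√(1 + u ^ 2))⁻¹ * u := rfl

lemma jump_pt (φ l u ω : ℝ) : (jump φ (pt l u) ω).1 =
    !₂[cos φ * ((√(1 + u ^ 2))⁻¹ * cos l) +
        sin φ * (-cos ω * sin l - sin ω * ((√(1 + u ^ 2))⁻¹ * u * cos l)),
      cos φ * ((√(1 + u ^ 2))⁻¹ * sin l) +
        sin φ * (cos ω * cos l - sin ω * ((√(1 + u ^ 2))⁻¹ * u * sin l)),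
      (√(1 + u ^ 2))⁻¹ * (cos φ * u + sin φ * sin ω)] := by
  set s := (√(1 + u ^ 2))⁻¹ with hs
  have h0 : (pt l u).1 0 = s * cos l := rfl
  have h1 : (pt l u).1 1 = s * sin l := rfl
  have h2 : (pt l u).1 2 = s * u := rfl
  have h4 := Real.sin_sq_add_cos_sq l
  ext i
  fin_cases i
  all_goals
    simp [jump, tangentPerp, tangentDir_pt, cross_apply, h0, h1, h2]
  · ring
  · ring
  · linear_combination sin φ * sin ω * s * h4

lemma jump_pt_two (φ l u ω : ℝ) :
    (jump φ (pt l u) ω).1 2 = (√(1 + u ^ 2))⁻¹ * (cos φ * u + sin φ * sin ω) := by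
  rw [jump_pt]; rfl

lemma jump_add_pi (φ : ℝ) (x : S2) (ω : ℝ) : jump φ x (ω + π) = jump (-φ) x ω := by
  refine Subtype.ext ?_
  simp only [jump, cos_add_pi, sin_add_pi, cos_neg, sin_neg]
  module

/-- The real part of the `k`-th power of the horizontal coordinate. -/
noncomputable def wave (k : ℕ) (x : S2) : ℝ := ((⟨x.1 0, x.1 1⟩ : ℂ) ^ k).re

lemma wave_polar (k : ℕ) (s l : ℝ) :
    ((⟨s * cos l, s * sin l⟩ : ℂ) ^ k).re = s ^ k * cos (k * l) := by
  have : (⟨s * cos l, s * sin l⟩ : ℂ) = s * Complex.exp (l * Complex.I) := by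
    rw [Complex.exp_mul_I]
    apply Complex.ext <;> simp [Complex.cos_ofReal_re, Complex.sin_ofReal_re]
  rw [this, mul_pow, ← Complex.exp_nat_mul, ← mul_assoc,
    show (k : ℂ) * (l : ℂ) = ((k * l : ℝ) : ℂ) by push_cast; ring, ← Complex.ofReal_pow,
    Complex.re_ofReal_mul, Complex.exp_ofReal_mul_I_re]

lemma wave_pt (k : ℕ) (l u : ℝ) :
    wave k (pt l u) = (√(1 + u ^ 2))⁻¹ ^ k * cos (k * l) := wave_polar k _ l

lemma continuous_wave (k : ℕ) : Continuous (wave k) := by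
  unfold wave
  refine Complex.continuous_re.comp (Continuous.pow ?_ k)
  have : (fun x : S2 => (⟨x.1 0, x.1 1⟩ : ℂ)) =
      fun x : S2 => ((x.1 0 : ℝ) : ℂ) + ((x.1 1 : ℝ) : ℂ) * Complex.I := by
    funext x
    apply Complex.ext <;> simp
  rw [this]
  fun_prop

lemma wave_neg {k : ℕ} (hk : Odd k) (x : S2) : wave k (-x) = -wave k x := by
  have : (⟨(-x).1 0, (-x).1 1⟩ : ℂ) = -⟨x.1 0, x.1 1⟩ := by
    apply Complex.ext <;> simp
  rw [wave, this, hk.neg_pow, Complex.neg_re, wave]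

lemma abs_wave_le_one (k : ℕ) (x : S2) : |wave k x| ≤ 1 := by
  refine (Complex.abs_re_le_norm _).trans ?_
  rw [norm_pow]
  refine pow_le_one₀ (norm_nonneg _) ?_
  rw [← sq_le_one_iff₀ (norm_nonneg _), Complex.sq_norm, Complex.normSq_mk]
  nlinarith [sq_add_sq_add_sq x, sq_nonneg (x.1 2)]

lemma abs_wave_pt_le {k : ℕ} (hk : k ≠ 0) (l u : ℝ) :
    |wave k (pt l u)| ≤ (√(1 + u ^ 2))⁻¹ := by
  have h0 : 0 ≤ (√(1 + u ^ 2))⁻¹ := by positivity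
  have h1 : (√(1 + u ^ 2))⁻¹ ≤ 1 := by
    refine inv_le_one_of_one_le₀ ?_
    rw [Real.one_le_sqrt]
    nlinarith [sq_nonneg u]
  rw [wave_pt, abs_mul, abs_of_nonneg (pow_nonneg h0 k)]
  calc _ ≤ (√(1 + u ^ 2))⁻¹ ^ k * 1 := by gcongr; exact abs_cos_le_one _
    _ ≤ _ := by rw [mul_one]; exact pow_le_of_le_one h0 h1 hk

/-- The wave at the end of a short-sloped jump along the equator. -/
lemma tendsto_wave_jump (k : ℕ) (φ l w η : ℝ) :
    Tendsto (fun ε => wave k (jump φ (pt l (ε * w)) (ε * η))) (𝓝[>] 0)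
      (𝓝 (cos (k * (l + φ)))) := by
  have hc : Continuous fun ε : ℝ => jump φ (pt l (ε * w)) (ε * η) := by
    refine Continuous.subtype_mk (f := fun ε : ℝ => (jump φ (pt l (ε * w)) (ε * η)).1) ?_ _
    simp only [jump_pt]
    have hs : Continuous fun ε : ℝ => (√(1 + (ε * w) ^ 2))⁻¹ :=
      Continuous.inv₀ (by fun_prop) fun u => (Real.sqrt_pos.mpr (by positivity)).ne'
    refine (PiLp.continuous_toLp 2 _).comp (continuous_pi fun i => ?_)
    fin_cases i
    all_goals
      simp
      fun_prop
  have h := ((continuous_wave k).comp hc).tendsto 0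
  have h0 : wave k (jump φ (pt l (0 * w)) (0 * η)) = cos (k * (l + φ)) := by
    have hw := wave_polar k 1 (l + φ)
    simp only [one_pow, one_mul] at hw
    rw [wave, jump_pt, ← hw]
    congr 2
    apply Complex.ext
    · simp [cos_add]; ring
    · simp [sin_add]; ring
  rw [Function.comp_apply, h0] at h
  exact h.mono_left nhdsWithin_le_nhds

/-! ### Lawns with a wavy boundary -/

open Classical in
/-- The function that is `1` on `L` and `-1` off `L`. -/
noncomputable def spin (L : Set S2) (x : S2) : ℝ := if x ∈ L then 1 else -1

lemma measurable_spin {L : Set S2} (hL : MeasurableSet L) : Measurable (spin L) :=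
  Measurable.ite hL measurable_const measurable_const

lemma abs_spin (L : Set S2) (x : S2) : |spin L x| = 1 := by
  unfold spin; split_ifs <;> simp

/-- The lawn above the wave of amplitude `ε`; points on the wave follow the lawn `H`. -/
def waveLawn (k : ℕ) (H : Set S2) (ε : ℝ) : Set S2 :=
  {x | ε * wave k x < x.1 2 ∨ (x.1 2 = ε * wave k x ∧ x ∈ H)}

lemma measurable_coord (i : Fin 3) : Measurable fun x : S2 => x.1 i :=
  Continuous.measurable (by fun_prop)

lemma isAntipodalLawn_waveLawn {k : ℕ} (hk : Odd k) {H : Set S2} (hH : IsAntipodalLawn H)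
    (ε : ℝ) : IsAntipodalLawn (waveLawn k H ε) := by
  have hw : Measurable fun x => ε * wave k x := (continuous_wave k).measurable.const_mul ε
  refine ⟨(measurableSet_lt hw (measurable_coord 2)).union
    ((measurableSet_eq_fun (measurable_coord 2) hw).inter hH.measurableSet), fun x => ?_⟩
  have h1 : (-x).1 2 = -x.1 2 := rfl
  simp only [waveLawn, Set.mem_ofPred_eq, h1, wave_neg hk, hH.neg_mem_iff, mul_neg, neg_lt_neg_iff,
    neg_inj, not_or, not_and, not_not, not_lt]
  constructor
  · rintro (h | ⟨h, h'⟩)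
    · exact ⟨h.le, fun h'' => absurd h'' h.ne'⟩
    · exact ⟨h.ge, fun _ => h'⟩
  · rintro ⟨h, h'⟩
    rcases h.lt_or_eq with h | h
    · exact Or.inl h
    · exact Or.inr ⟨h.symm, h' h.symm⟩

lemma spin_waveLawn_eq_sign {k : ℕ} {H : Set S2} {ε : ℝ} {x : S2} (h : x.1 2 ≠ ε * wave k x) :
    spin (waveLawn k H ε) x = Real.sign (x.1 2 - ε * wave k x) := by
  rcases lt_or_gt_of_ne h with h' | h'
  · rw [Real.sign_of_neg (sub_neg.mpr h'), spin, if_neg]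
    simp [waveLawn, h, h'.le]
  · rw [Real.sign_of_pos (sub_pos.mpr h'), spin,
      if_pos (show x ∈ waveLawn k H ε from Or.inl h')]

/-- A lawn containing the northern open hemisphere. -/
structure IsNorthernLawn (H : Set S2) : Prop extends IsAntipodalLawn H where
  subset : {x : S2 | 0 < x.1 2} ⊆ H

lemma IsNorthernLawn.spin_eq_sign {H : Set S2} (hH : IsNorthernLawn H) {x : S2}
    (h : x.1 2 ≠ 0) : spin H x = Real.sign (x.1 2) := by
  rcases lt_or_gt_of_ne h with h' | h'
  · have h1 : -x ∈ H := hH.subset (by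
      change 0 < -x.1 2
      linarith)
    rw [Real.sign_of_neg h', spin, if_neg ((hH.neg_mem_iff x).mp h1)]
  · rw [Real.sign_of_pos h', spin, if_pos (hH.subset h')]

/-- The difference between the wavy and the hemispherical lawn. -/
noncomputable def lawnDiff (k : ℕ) (H : Set S2) (ε : ℝ) (x : S2) : ℝ :=
  spin (waveLawn k H ε) x - spin H x

section

variable {k : ℕ} {H : Set S2} {ε : ℝ}

lemma measurable_lawnDiff (hk : Odd k) (hH : IsAntipodalLawn H) (ε : ℝ) :
    Measurable (lawnDiff k H ε) :=
  (measurable_spin (isAntipodalLawn_waveLawn hk hH ε).measurableSet).sub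
    (measurable_spin hH.measurableSet)

lemma abs_lawnDiff_le (k : ℕ) (H : Set S2) (ε : ℝ) (x : S2) : |lawnDiff k H ε x| ≤ 2 := by
  refine (abs_sub _ _).trans ?_
  rw [abs_spin, abs_spin]; norm_num

lemma lawnDiff_eq_zero (hH : IsNorthernLawn H) (hε : 0 ≤ ε) {x : S2}
    (h : ε * |wave k x| < |x.1 2|) : lawnDiff k H ε x = 0 := by
  have h1 : |ε * wave k x| < |x.1 2| := by rwa [abs_mul, abs_of_nonneg hε]
  have h0 : x.1 2 ≠ 0 := by
    intro h0
    rw [h0, abs_zero] at h1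
    exact absurd h1 (abs_nonneg _).not_gt
  have hne : x.1 2 ≠ ε * wave k x := fun h2 => by rw [h2] at h1; exact lt_irrefl _ h1
  rw [lawnDiff, spin_waveLawn_eq_sign hne, hH.spin_eq_sign h0]
  have h2 := abs_lt.mp h1
  rcases lt_or_gt_of_ne h0 with h' | h'
  · rw [abs_of_neg h'] at h2
    rw [Real.sign_of_neg h', Real.sign_of_neg (by linarith), sub_self]
  · rw [abs_of_pos h'] at h2
    rw [Real.sign_of_pos h', Real.sign_of_pos (by linarith), sub_self]

/-- The height `u / √(1 + u ^ 2)` and the bound on the wave carry the same factor, so the strip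
where the lawns differ lies in slopes at most `ε`. -/
lemma lawnDiff_pt_eq_zero (hk : k ≠ 0) (hH : IsNorthernLawn H) (hε : 0 < ε) {l u : ℝ}
    (h : ε < |u|) : lawnDiff k H ε (pt l u) = 0 := by
  refine lawnDiff_eq_zero hH hε.le ?_
  have hs : 0 < (√(1 + u ^ 2))⁻¹ := inv_pos.mpr (Real.sqrt_pos.mpr (by positivity))
  rw [pt_two, abs_mul, abs_of_pos hs]
  calc ε * |wave k (pt l u)| ≤ ε * (√(1 + u ^ 2))⁻¹ := by gcongr; exact abs_wave_pt_le hk l u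
    _ = (√(1 + u ^ 2))⁻¹ * ε := mul_comm _ _
    _ < _ := by gcongr

/-- The end of the jump has height `s * (cos φ * u + sin φ * sin ω)` with `s ≥ 1 / 2`. The first
term is at most `ε`; by Jordan's inequality `|sin ω| ≥ 2 |ω| / π`, the constant makes the second
exceed `3 * ε`. So the height exceeds `ε`, which bounds the wave. -/
lemma lawnDiff_jump_eq_zero {φ : ℝ} (hφ : sin φ ≠ 0) (hH : IsNorthernLawn H) (hε : 0 < ε)
    (hε1 : ε ≤ 1) {l u ω : ℝ} (hu : |u| ≤ ε) (hω : |ω| ≤ π / 2)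
    (h : 3 * π / (2 * |sin φ|) * ε < |ω|) : lawnDiff k H ε (jump φ (pt l u) ω) = 0 := by
  refine lawnDiff_eq_zero hH hε.le ?_
  have hsp : 0 < |sin φ| := abs_pos.mpr hφ
  set s := (√(1 + u ^ 2))⁻¹ with hs
  have hs2 : 1 / 2 ≤ s := by
    rw [hs, one_div]
    refine inv_anti₀ (Real.sqrt_pos.mpr (by positivity)) ?_
    rw [Real.sqrt_le_left (by norm_num)]
    have : u ^ 2 ≤ 1 := by rw [sq_le_one_iff_abs_le_one]; linarith
    linarith
  have h1 : 3 * ε < |sin φ * sin ω| := by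
    have hj : 2 / π * |ω| ≤ |sin ω| := Real.mul_abs_le_abs_sin hω
    rw [abs_mul]
    have hpi := pi_pos
    calc 3 * ε = |sin φ| * (2 / π * (3 * π / (2 * |sin φ|) * ε)) := by field_simp
      _ < |sin φ| * (2 / π * |ω|) := by gcongr
      _ ≤ _ := by gcongr
  have h2 : |cos φ * u| ≤ ε := by
    rw [abs_mul]
    calc |cos φ| * |u| ≤ 1 * ε := by gcongr; exact abs_cos_le_one φ
      _ = ε := one_mul ε
  have h3 : 2 * ε < |cos φ * u + sin φ * sin ω| := by
    have := abs_sub_abs_le_abs_sub (sin φ * sin ω) (-(cos φ * u))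
    rw [abs_neg, sub_neg_eq_add, add_comm (sin φ * sin ω)] at this
    linarith
  rw [jump_pt_two, abs_mul, abs_of_pos (by linarith : 0 < s)]
  calc ε * |wave k _| ≤ ε * 1 := by gcongr; exact abs_wave_le_one _ _
    _ = 1 / 2 * (2 * ε) := by ring
    _ < 1 / 2 * |cos φ * u + sin φ * sin ω| := by gcongr
    _ ≤ _ := by gcongr

/-- After division by `ε`, the heights over the equator and over the wave tend to the nonzero
numbers `a` and `a - h`. Their signs are thus eventually constant, and so is `lawnDiff`. -/
lemma tendsto_lawnDiff (hH : IsNorthernLawn H) {x : ℝ → S2} {a h : ℝ}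
    (ha : Tendsto (fun ε => (x ε).1 2 / ε) (𝓝[>] 0) (𝓝 a))
    (hh : Tendsto (fun ε => wave k (x ε)) (𝓝[>] 0) (𝓝 h)) (ha0 : a ≠ 0) (hah : a ≠ h) :
    Tendsto (fun ε => lawnDiff k H ε (x ε)) (𝓝[>] 0) (𝓝 (signChange a h)) := by
  have hsign : ∀ (f : ℝ → ℝ) (b : ℝ), b ≠ 0 → Tendsto (fun ε => f ε / ε) (𝓝[>] 0) (𝓝 b) →
      ∀ᶠ ε in 𝓝[>] 0, f ε ≠ 0 ∧ Real.sign (f ε) = Real.sign b := by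
    intro f b hb hf
    rcases lt_or_gt_of_ne hb with h' | h'
    · filter_upwards [hf.eventually (gt_mem_nhds h'), self_mem_nhdsWithin] with ε h1 h2
      have : f ε < 0 := by
        by_contra hc
        exact absurd h1 (div_nonneg (not_lt.mp hc) (le_of_lt h2)).not_gt
      exact ⟨this.ne, by rw [Real.sign_of_neg this, Real.sign_of_neg h']⟩
    · filter_upwards [hf.eventually (lt_mem_nhds h'), self_mem_nhdsWithin] with ε h1 h2
      have : 0 < f ε := by
        by_contra hc
        exact absurd h1 (div_nonpos_of_nonpos_of_nonneg (not_lt.mp hc) (le_of_lt h2)).not_gt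
      exact ⟨this.ne', by rw [Real.sign_of_pos this, Real.sign_of_pos h']⟩
  have h1 := hsign _ _ ha0 ha
  have h2 := hsign (fun ε => (x ε).1 2 - ε * wave k (x ε)) (a - h) (sub_ne_zero.mpr hah) (by
    refine (ha.sub hh).congr' ?_
    filter_upwards [self_mem_nhdsWithin] with ε hε
    have : ε ≠ 0 := ne_of_gt hε
    field_simp)
  refine tendsto_const_nhds.congr' ?_
  filter_upwards [h1, h2] with ε h3 h4
  rw [lawnDiff, spin_waveLawn_eq_sign (sub_ne_zero.mp h4.1), hH.spin_eq_sign h3.1, h3.2, h4.2,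
    signChange]

lemma tendsto_inv_sqrt (w : ℝ) :
    Tendsto (fun ε : ℝ => (√(1 + (ε * w) ^ 2))⁻¹) (𝓝[>] 0) (𝓝 1) := by
  have hs : Continuous fun ε : ℝ => (√(1 + (ε * w) ^ 2))⁻¹ :=
    Continuous.inv₀ (by fun_prop) fun u => (Real.sqrt_pos.mpr (by positivity)).ne'
  have := hs.tendsto 0
  simp only [zero_mul] at this
  norm_num at this
  exact this.mono_left nhdsWithin_le_nhds

lemma tendsto_comp_mul_div {f : ℝ → ℝ} {f' : ℝ} (hf : HasDerivAt f f' 0) (h0 : f 0 = 0) (w : ℝ) :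
    Tendsto (fun ε => f (ε * w) / ε) (𝓝[>] 0) (𝓝 (f' * w)) := by
  have h1 : HasDerivAt (fun ε => f (ε * w)) (f' * w) 0 := by
    have h2 : HasDerivAt (fun ε : ℝ => ε * w) w 0 := by simpa using (hasDerivAt_id 0).mul_const w
    exact HasDerivAt.comp 0 (h₂ := f) (by simpa using hf) h2
  have := h1.tendsto_slope_zero_right
  simpa [h0, div_eq_inv_mul] using this

lemma tendsto_lawnDiff_pt (hH : IsNorthernLawn H) {l w : ℝ} (h0 : w ≠ 0)
    (h1 : w ≠ cos (k * l)) : Tendsto (fun ε => lawnDiff k H ε (pt l (ε * w))) (𝓝[>] 0)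
      (𝓝 (signChange w (cos (k * l)))) := by
  refine tendsto_lawnDiff hH ?_ ?_ h0 h1
  · have := (tendsto_inv_sqrt w).mul_const w
    rw [one_mul] at this
    refine this.congr' ?_
    filter_upwards [self_mem_nhdsWithin] with ε hε
    have : ε ≠ 0 := ne_of_gt hε
    rw [pt_two]
    field_simp
  · have := ((tendsto_inv_sqrt w).pow k).mul_const (cos (k * l))
    rw [one_pow, one_mul] at this
    simpa only [wave_pt] using this

lemma tendsto_lawnDiff_jump (hH : IsNorthernLawn H) {φ l w η : ℝ}
    (h0 : cos φ * w + sin φ * η ≠ 0) (h1 : cos φ * w + sin φ * η ≠ cos (k * (l + φ))) :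
    Tendsto (fun ε => lawnDiff k H ε (jump φ (pt l (ε * w)) (ε * η))) (𝓝[>] 0)
      (𝓝 (signChange (cos φ * w + sin φ * η) (cos (k * (l + φ))))) := by
  refine tendsto_lawnDiff hH ?_ (tendsto_wave_jump k φ l w η) h0 h1
  have hsin := tendsto_comp_mul_div (Real.hasDerivAt_sin 0) Real.sin_zero η
  rw [Real.cos_zero, one_mul] at hsin
  have := (tendsto_inv_sqrt w).mul ((tendsto_const_nhds (x := cos φ * w)).add
    (hsin.const_mul (sin φ)))
  rw [one_mul] at this
  refine this.congr' ?_
  filter_upwards [self_mem_nhdsWithin] with ε hε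
  have : ε ≠ 0 := ne_of_gt hε
  rw [jump_pt_two]
  field_simp

/-- On average over directions with a forward component, the end of a jump from slope `u`. -/
lemma integral_spin_jump (hH : IsNorthernLawn H) {φ : ℝ} (hφ : sin φ ≠ 0) (l u : ℝ) :
    ∫ ω in -(π / 2)..π / 2, spin H (jump φ (pt l u) ω) =
      2 * arcsin (cos φ / |sin φ| * u) := by
  have hs : 0 < (√(1 + u ^ 2))⁻¹ := inv_pos.mpr (Real.sqrt_pos.mpr (by positivity))
  have hpos : ∀ ω, 0 < cos φ * u + sin φ * sin ω → spin H (jump φ (pt l u) ω) = 1 := by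
    intro ω h
    have h' : 0 < (jump φ (pt l u) ω).1 2 := by rw [jump_pt_two]; positivity
    rw [hH.spin_eq_sign h'.ne', Real.sign_of_pos h']
  have hneg : ∀ ω, cos φ * u + sin φ * sin ω < 0 → spin H (jump φ (pt l u) ω) = -1 := by
    intro ω h
    have h' : (jump φ (pt l u) ω).1 2 < 0 := by
      rw [jump_pt_two]; exact mul_neg_of_pos_of_neg hs h
    rw [hH.spin_eq_sign h'.ne, Real.sign_of_neg h']
  -- The height of the end is monotone in `sin ω`, falling if `sin φ < 0` and rising otherwise, and
  -- changes sign at an arcsine. If the argument of the arcsine exceeds `1` in absolute value, there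
  -- is no change of sign, and the clamped value `±π / 2` correctly leaves one of the two pieces
  -- empty.
  rcases lt_or_gt_of_ne hφ with h0 | h0
  · rw [abs_of_neg h0]
    set t := cos φ / -sin φ * u with ht
    have htu : cos φ * u = -sin φ * t := by rw [ht]; field_simp
    have h1 := Real.neg_pi_div_two_le_arcsin t
    have h2 := Real.arcsin_le_pi_div_two t
    have := (integral_step (f := fun ω => -spin H (jump φ (pt l u) ω)) (g := fun _ => 1)
      continuous_const h1 h2 (fun ω hω => ?_) (fun ω hω => ?_)).2
    · rw [intervalIntegral.integral_neg] at this
      simp at this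
      linarith
    · refine neg_inj.mpr (hpos ω ?_)
      have h3 : sin ω < t :=
        (Real.lt_arcsin_iff_sin_lt' ⟨hω.1.le, hω.2.trans_le h2⟩).mp hω.2
      rw [htu]; nlinarith
    · have h3 : t < sin ω := (Real.arcsin_lt_iff_lt_sin' ⟨h1.trans_lt hω.1, hω.2.le⟩).mp hω.1
      change -spin H (jump φ (pt l u) ω) = 1
      rw [hneg ω (by rw [htu]; nlinarith), neg_neg]
  · rw [abs_of_pos h0]
    set t := cos φ / sin φ * u with ht
    have htu : cos φ * u = sin φ * t := by rw [ht]; field_simp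
    have h1 := Real.neg_pi_div_two_le_arcsin (-t)
    have h2 := Real.arcsin_le_pi_div_two (-t)
    have := (integral_step (f := fun ω => spin H (jump φ (pt l u) ω)) (g := fun _ => 1)
      continuous_const h1 h2 (fun ω hω => ?_) (fun ω hω => ?_)).2
    · rw [Real.arcsin_neg] at this
      simp at this
      linarith
    · refine hneg ω ?_
      have h3 : sin ω < -t :=
        (Real.lt_arcsin_iff_sin_lt' ⟨hω.1.le, hω.2.trans_le h2⟩).mp hω.2
      rw [htu]; nlinarith
    · have h3 : -t < sin ω := (Real.arcsin_lt_iff_lt_sin' ⟨h1.trans_lt hω.1, hω.2.le⟩).mp hω.1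
      exact hpos ω (by rw [htu]; nlinarith)

lemma abs_arcsin_le (x : ℝ) : |arcsin x| ≤ π / 2 * |x| := by
  have hpi := pi_pos
  have h : ∀ y : ℝ, 0 ≤ y → arcsin y ≤ π / 2 * y := by
    intro y hy
    rcases le_or_gt y 1 with h1 | h1
    · have := Real.mul_le_sin (Real.arcsin_nonneg.mpr hy) (Real.arcsin_le_pi_div_two y)
      rw [Real.sin_arcsin (by linarith) h1] at this
      calc arcsin y = π / 2 * (2 / π * arcsin y) := by field_simp
        _ ≤ _ := by gcongr
    · refine (Real.arcsin_le_pi_div_two y).trans ?_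
      nlinarith
  rcases le_total 0 x with hx | hx
  · rw [abs_of_nonneg hx, abs_of_nonneg (Real.arcsin_nonneg.mpr hx)]
    exact h x hx
  · rw [abs_of_nonpos hx, abs_of_nonpos (Real.arcsin_nonpos.mpr hx), ← Real.arcsin_neg]
    exact h (-x) (by linarith)

end

/-! ### Second-order expansion of the gain -/

lemma integral_eq_scaled {f : ℝ → ℝ} {ε M : ℝ} (hε : 0 < ε) (hM : 0 ≤ M)
    (h : ∀ u, M * ε < |u| → f u = 0) : ∫ u, f u = ε * ∫ w in -M..M, f (ε * w) := by
  have hle : ε * -M ≤ ε * M := by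
    have : 0 ≤ ε * M := by positivity
    linarith
  rw [intervalIntegral.mul_integral_comp_mul_left, intervalIntegral.integral_of_le hle,
    ← integral_Icc_eq_integral_Ioc, setIntegral_eq_integral_of_forall_compl_eq_zero]
  intro u hu
  refine h u ?_
  by_contra hc
  have := abs_le.mp (not_lt.mp hc)
  exact hu ⟨by linarith, by linarith⟩

lemma intervalIntegral_eq_scaled {f : ℝ → ℝ} {ε M b : ℝ} (hε : 0 < ε) (hM : 0 ≤ M)
    (hb : M * ε < b) (h : ∀ u, |u| ≤ b → M * ε < |u| → f u = 0) :
    ∫ u in -b..b, f u = ε * ∫ w in -M..M, f (ε * w) := by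
  have hb0 : 0 ≤ b := le_trans (by positivity) hb.le
  rw [intervalIntegral.integral_of_le (by linarith), ← integral_indicator measurableSet_Ioc,
    integral_eq_scaled hε hM]
  · congr 1
    refine intervalIntegral.integral_congr fun w hw => ?_
    rw [Set.uIcc_of_le (by linarith)] at hw
    exact Set.indicator_of_mem (s := Set.Ioc (-b) b) ⟨by nlinarith [hw.1], by nlinarith [hw.2]⟩ f
  · intro u hu
    by_cases hub : u ∈ Set.Ioc (-b) b
    · rw [Set.indicator_of_mem hub]
      exact h u (abs_le.mpr ⟨hub.1.le, hub.2⟩) hu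
    · exact Set.indicator_of_notMem hub f

/-- The range of the rescaled jump directions that connect the strip around the equator
to itself. -/
noncomputable def dirBound (φ : ℝ) : ℝ := 3 * π / (2 * |sin φ|)

/-- The contribution of the directions in `(-π/2, π/2)` to the gain of the wavy lawn over the
hemispherical one. -/
noncomputable def halfGain (k : ℕ) (H : Set S2) (φ ε : ℝ) : ℝ :=
  ∫ x, (lawnDiff k H ε x * ∫ ω in -(π / 2)..π / 2,
    (lawnDiff k H ε (jump φ x ω) + 2 * spin H (jump φ x ω))) ∂area

/-- The rescaled contribution to `halfGain` of the starting point of longitude `l` and slope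
`ε * w`. -/
noncomputable def profile (k : ℕ) (H : Set S2) (φ ε l w : ℝ) : ℝ :=
  (∫ η in -dirBound φ..dirBound φ, lawnDiff k H ε (jump φ (pt l (ε * w)) (ε * η))) +
    4 * (arcsin (cos φ / |sin φ| * (ε * w)) / ε)

section

variable {k : ℕ} {H : Set S2} {φ : ℝ}

lemma intervalIntegrable_jump {f : S2 → ℝ} (hf : Measurable f) {C : ℝ} (hC : ∀ x, |f x| ≤ C)
    (φ : ℝ) (x : S2) (a b : ℝ) : IntervalIntegrable (fun ω => f (jump φ x ω)) volume a b := by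
  have hm : Measurable fun ω => f (jump φ x ω) :=
    hf.comp ((measurable_jump φ).comp (measurable_const.prodMk measurable_id))
  exact (intervalIntegrable_const (c := C)).mono_fun hm.aestronglyMeasurable
    (Eventually.of_forall fun ω => by
      simpa only [Real.norm_eq_abs] using (hC _).trans (le_abs_self C))

lemma dirBound_pos (hφ : sin φ ≠ 0) : 0 < dirBound φ := by
  have := pi_pos
  have : 0 < |sin φ| := abs_pos.mpr hφ
  unfold dirBound; positivity

/-- One factor `ε` comes from the slope `u = ε * w` of the start. The other comes from the direction
integral: its perturbation term lives on `ω = ε * η`, and its hemisphere term is an arcsine of size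
`O(ε)`. -/
lemma halfGain_eq (hk : Odd k) (hH : IsNorthernLawn H) (hφ : sin φ ≠ 0) {ε : ℝ} (hε : 0 < ε)
    (hε1 : ε ≤ 1) (hε2 : dirBound φ * ε < π / 2) :
    halfGain k H φ ε = ε ^ 2 * ∫ l in -π..π, ∫ w in -1..1,
      dens (ε * w) * (lawnDiff k H ε (pt l (ε * w)) * profile k H φ ε l w) := by
  have hD := measurable_lawnDiff hk hH.toIsAntipodalLawn ε
  have hS := measurable_spin hH.measurableSet
  set g : S2 → ℝ := fun x => ∫ ω in -(π / 2)..π / 2,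
    (lawnDiff k H ε (jump φ x ω) + 2 * spin H (jump φ x ω)) with hg
  have hb : ∀ y, |lawnDiff k H ε y + 2 * spin H y| ≤ 4 := fun y => by
    refine (abs_add_le _ _).trans ?_
    rw [abs_mul, abs_spin]
    have := abs_lawnDiff_le k H ε y
    norm_num
    linarith
  have hgm : Measurable g :=
    measurable_intervalIntegral (f := fun x ω => lawnDiff k H ε (jump φ x ω) +
      2 * spin H (jump φ x ω)) ((hD.add (hS.const_mul 2)).comp (measurable_jump φ)) _ _
  have hgb : ∀ x, |g x| ≤ 4 * |π / 2 - -(π / 2)| := fun x =>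
    abs_intervalIntegral_le fun ω _ => hb _
  have h1 : halfGain k H φ ε = ∫ l in -π..π, ∫ u, dens u * (lawnDiff k H ε (pt l u) *
      g (pt l u)) := by
    refine integral_area_eq (f := fun x => lawnDiff k H ε x * g x) (hD.mul hgm)
      (C := 2 * (4 * |π / 2 - -(π / 2)|)) fun x => ?_
    rw [abs_mul]
    exact mul_le_mul (abs_lawnDiff_le k H ε x) (hgb x) (abs_nonneg _) (by norm_num)
  rw [h1, ← intervalIntegral.integral_const_mul]
  refine intervalIntegral.integral_congr fun l _ => ?_
  rw [integral_eq_scaled hε zero_le_one, sq, mul_assoc]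
  · congr 1
    rw [← intervalIntegral.integral_const_mul]
    refine intervalIntegral.integral_congr fun w hw => ?_
    rw [Set.uIcc_of_le (by norm_num)] at hw
    have hw' : |ε * w| ≤ ε := by
      rw [abs_mul, abs_of_pos hε]
      exact mul_le_of_le_one_right hε.le (abs_le.mpr hw)
    have h2 : g (pt l (ε * w)) = ε * profile k H φ ε l w := by
      rw [hg]
      simp only
      rw [intervalIntegral.integral_add
        (intervalIntegrable_jump hD (abs_lawnDiff_le k H ε) _ _ _ _)
        ((intervalIntegrable_jump hS (fun x => (abs_spin H x).le) _ _ _ _).const_mul 2),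
        intervalIntegral.integral_const_mul, integral_spin_jump hH hφ,
        intervalIntegral_eq_scaled hε (dirBound_pos hφ).le hε2 fun ω hω1 hω2 =>
          lawnDiff_jump_eq_zero hφ hH hε hε1 hw' hω1 hω2, profile]
      field_simp
      ring
    simp only [h2]
    ring
  · intro u hu
    rw [lawnDiff_pt_eq_zero hk.pos.ne' hH hε (by linarith), zero_mul, mul_zero]

lemma measurable_profile (hk : Odd k) (hH : IsNorthernLawn H) (φ ε : ℝ) :
    Measurable fun p : ℝ × ℝ => profile k H φ ε p.1 p.2 := by
  have hD := measurable_lawnDiff hk hH.toIsAntipodalLawn ε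
  refine Measurable.add ?_ ?_
  · refine measurable_intervalIntegral (f := fun (p : ℝ × ℝ) (η : ℝ) =>
      lawnDiff k H ε (jump φ (pt p.1 (ε * p.2)) (ε * η))) (hD.comp ?_) _ _
    refine (measurable_jump φ).comp (f := fun q : (ℝ × ℝ) × ℝ =>
      (pt q.1.1 (ε * q.1.2), ε * q.2)) (Measurable.prodMk ?_ (by fun_prop))
    exact measurable_pt.comp (f := fun q : (ℝ × ℝ) × ℝ => (q.1.1, ε * q.1.2)) (by fun_prop)
  · have := Real.continuous_arcsin.measurable
    fun_prop

lemma abs_profile_le (k : ℕ) (H : Set S2) (φ : ℝ) {ε : ℝ} (hε : 0 < ε) (l : ℝ) {w : ℝ}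
    (hw : |w| ≤ 1) : |profile k H φ ε l w| ≤
      2 * |dirBound φ - -dirBound φ| + 4 * (π / 2 * |cos φ / (|sin φ|)|) := by
  refine (abs_add_le _ _).trans (add_le_add
    (abs_intervalIntegral_le fun η _ => abs_lawnDiff_le k H ε _) ?_)
  have hpi := pi_pos
  rw [abs_mul, abs_of_pos (by norm_num : (0 : ℝ) < 4)]
  gcongr
  rw [abs_div, abs_of_pos hε, div_le_iff₀ hε]
  refine (abs_arcsin_le _).trans ?_
  rw [abs_mul, abs_mul, abs_of_pos hε, mul_assoc]
  gcongr
  exact mul_le_of_le_one_right hε.le hw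

/-- In the limit the jump is affine: it ends at longitude `l + φ` and rescaled slope `cos φ * w +
sin φ * η`. Integrating `signChange` over `η` gives the first term, and the derivative of the
arcsine at zero the second. -/
lemma tendsto_profile (hk : Odd k) (hH : IsNorthernLawn H) (hφ : sin φ ≠ 0) (l : ℝ) {w : ℝ}
    (hw : |w| ≤ 1) : Tendsto (fun ε => profile k H φ ε l w) (𝓝[>] 0)
      (𝓝 (-2 * cos (k * (l + φ)) / |sin φ| + 4 * (cos φ / |sin φ| * w))) := by
  refine Tendsto.add ?_ (Tendsto.const_mul 4 ?_)
  · have hcov : 1 + |cos φ * w| ≤ |sin φ| * dirBound φ := by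
      have h1 : |cos φ * w| ≤ 1 := by
        rw [abs_mul]
        exact mul_le_one₀ (abs_cos_le_one φ) (abs_nonneg _) hw
      have h2 : |sin φ| ≠ 0 := abs_ne_zero.mpr hφ
      have h3 : |sin φ| * dirBound φ = 3 * π / 2 := by unfold dirBound; field_simp
      have := pi_gt_three
      linarith
    rw [← integral_signChange_affine hφ hcov (abs_cos_le_one (k * (l + φ)))]
    refine tendsto_intervalIntegral_of_bounded (C := 2) (fun ε => ?_)
      (Eventually.of_forall fun ε η _ => abs_lawnDiff_le k H ε _) ?_
    · exact (measurable_lawnDiff hk hH.toIsAntipodalLawn ε).comp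
        ((measurable_jump φ).comp (measurable_const.prodMk (measurable_const_mul ε)))
    · have h0 : ∀ b : ℝ, ∀ᵐ η : ℝ, cos φ * w + sin φ * η ≠ b := by
        intro b
        filter_upwards [Measure.ae_ne volume ((b - cos φ * w) / sin φ)] with η hη h
        apply hη
        rw [← h]; field_simp; ring
      filter_upwards [h0 0, h0 (cos (k * (l + φ)))] with η h1 h2 _
      exact tendsto_lawnDiff_jump hH h1 h2
  · have hd : HasDerivAt (fun x => arcsin (cos φ / |sin φ| * x)) (cos φ / |sin φ|) 0 := by
      have h1 : HasDerivAt arcsin 1 (cos φ / |sin φ| * 0) := by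
        rw [mul_zero]
        simpa using Real.hasDerivAt_arcsin (x := 0) (by norm_num) (by norm_num)
      have h2 : HasDerivAt (fun x : ℝ => cos φ / |sin φ| * x) (cos φ / |sin φ|) 0 := by
        simpa using (hasDerivAt_id (0 : ℝ)).const_mul (cos φ / |sin φ|)
      have h3 := HasDerivAt.comp 0 h1 h2
      rwa [one_mul] at h3
    exact tendsto_comp_mul_div hd (by simp) w

lemma integral_cos_mul_cos (hk : k ≠ 0) (φ : ℝ) :
    ∫ l in -π..π, cos (k * l) * cos (k * (l + φ)) = π * cos (k * φ) := by
  have hk0 : (k : ℝ) ≠ 0 := by exact_mod_cast hk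
  have h1 : ∀ l : ℝ, cos (k * l) * cos (k * (l + φ)) =
      2⁻¹ * cos (k * φ) + 2⁻¹ * cos (k * φ + 2 * k * l) := by
    intro l
    have h2 := Real.two_mul_cos_mul_cos (k * l) (k * (l + φ))
    rw [show k * l - k * (l + φ) = -(k * φ) by ring, cos_neg,
      show k * l + k * (l + φ) = k * φ + 2 * k * l by ring] at h2
    linarith
  simp only [h1]
  rw [intervalIntegral.integral_add (by simp) (Continuous.intervalIntegrable (by fun_prop) _ _),
    intervalIntegral.integral_const, intervalIntegral.integral_const_mul,
    intervalIntegral.integral_comp_add_mul cos (by positivity), integral_cos]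
  have h3 : sin (k * φ + 2 * k * π) = sin (k * φ + 2 * k * -π) := by
    rw [show k * φ + 2 * k * π = (k * φ + 2 * k * -π) + (2 * k : ℕ) * (2 * π) by push_cast; ring,
      Real.sin_add_nat_mul_two_pi]
  rw [h3, sub_self, smul_zero, mul_zero, smul_eq_mul]
  ring

/-- With `h = cos (k * l)`, integrating over `w` turns `1` into `-2 * h` and `w` into `-h ^ 2`. The
first yields the correlation of the wave with its shift by `φ`, the second its mean square, written
below as the correlation with shift `0`. -/
lemma integral_signChange_profile (hk : k ≠ 0) (φ : ℝ) :
    ∫ l in -π..π, (∫ w in -1..1, signChange w (cos (k * l)) *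
      (-2 * cos (k * (l + φ)) / |sin φ| + 4 * (cos φ / |sin φ| * w))) =
      4 * π / |sin φ| * (cos (k * φ) - cos φ) := by
  have h1 : ∀ l : ℝ, ∫ w in -1..1, signChange w (cos (k * l)) *
      (-2 * cos (k * (l + φ)) / |sin φ| + 4 * (cos φ / |sin φ| * w)) =
      4 / |sin φ| * (cos (k * l) * cos (k * (l + φ))) -
        4 * cos φ / |sin φ| * (cos (k * l) * cos (k * (l + 0))) := by
    intro l
    rw [integral_signChange_mul (g := fun w => -2 * cos (k * (l + φ)) / |sin φ| +
      4 * (cos φ / |sin φ| * w)) (by fun_prop) le_rfl le_rfl (abs_cos_le_one _),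
      intervalIntegral.integral_add (by simp) (Continuous.intervalIntegrable (by fun_prop) _ _),
      intervalIntegral.integral_const, intervalIntegral.integral_const_mul,
      intervalIntegral.integral_const_mul, integral_id, smul_eq_mul, add_zero]
    ring
  simp only [h1]
  rw [intervalIntegral.integral_sub (Continuous.intervalIntegrable (by fun_prop) _ _)
    (Continuous.intervalIntegrable (by fun_prop) _ _), intervalIntegral.integral_const_mul,
    intervalIntegral.integral_const_mul, integral_cos_mul_cos hk,
    integral_cos_mul_cos hk, mul_zero, cos_zero]
  ring

/-- The rescaled integrand of `halfGain`. -/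
noncomputable def gainDensity (k : ℕ) (H : Set S2) (φ ε l w : ℝ) : ℝ :=
  dens (ε * w) * (lawnDiff k H ε (pt l (ε * w)) * profile k H φ ε l w)

lemma measurable_gainDensity (hk : Odd k) (hH : IsNorthernLawn H) (φ ε : ℝ) :
    Measurable fun p : ℝ × ℝ => gainDensity k H φ ε p.1 p.2 := by
  refine Measurable.mul (continuous_dens.measurable.comp (by fun_prop)) (Measurable.mul
    ((measurable_lawnDiff hk hH.toIsAntipodalLawn ε).comp ?_) (measurable_profile hk hH φ ε))
  exact measurable_pt.comp (f := fun p : ℝ × ℝ => (p.1, ε * p.2)) (by fun_prop)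

lemma exists_abs_gainDensity_le (k : ℕ) (H : Set S2) (φ : ℝ) : ∃ C, ∀ ε, 0 < ε →
    ∀ l, ∀ w ∈ Set.uIoc (-1 : ℝ) 1, |gainDensity k H φ ε l w| ≤ C := by
  refine ⟨1 * (2 * (2 * |dirBound φ - -dirBound φ| + 4 * (π / 2 * |cos φ / (|sin φ|)|))),
    fun ε hε l w hw => ?_⟩
  rw [Set.uIoc_of_le (by norm_num)] at hw
  rw [gainDensity, abs_mul, abs_mul, abs_of_nonneg (dens_nonneg _)]
  exact mul_le_mul (dens_le_one _) (mul_le_mul (abs_lawnDiff_le k H ε _)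
    (abs_profile_le k H φ hε l (abs_le.mpr ⟨hw.1.le, hw.2⟩)) (abs_nonneg _) (by norm_num))
    (by positivity) zero_le_one

lemma tendsto_gainDensity (hk : Odd k) (hH : IsNorthernLawn H) (hφ : sin φ ≠ 0) {l w : ℝ}
    (hw : |w| ≤ 1) (h0 : w ≠ 0) (h1 : w ≠ cos (k * l)) :
    Tendsto (fun ε => gainDensity k H φ ε l w) (𝓝[>] 0) (𝓝 (signChange w (cos (k * l)) *
      (-2 * cos (k * (l + φ)) / |sin φ| + 4 * (cos φ / |sin φ| * w)))) := by
  have hdens : Tendsto (fun ε => dens (ε * w)) (𝓝[>] 0) (𝓝 1) := by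
    have h3 : Continuous fun ε => dens (ε * w) := continuous_dens.comp (by fun_prop)
    have h4 := h3.tendsto 0
    rw [zero_mul, dens_zero] at h4
    exact h4.mono_left nhdsWithin_le_nhds
  have := hdens.mul ((tendsto_lawnDiff_pt (k := k) (l := l) hH h0 h1).mul
    (tendsto_profile hk hH hφ l hw))
  rwa [one_mul] at this

lemma tendsto_integral_gainDensity (hk : Odd k) (hH : IsNorthernLawn H) (hφ : sin φ ≠ 0) :
    Tendsto (fun ε => ∫ l in -π..π, ∫ w in -1..1, gainDensity k H φ ε l w) (𝓝[>] 0)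
      (𝓝 (4 * π / |sin φ| * (cos (k * φ) - cos φ))) := by
  obtain ⟨C, hC⟩ := exists_abs_gainDensity_le k H φ
  have hm := measurable_gainDensity hk hH φ
  have hml : ∀ ε l, Measurable fun w => gainDensity k H φ ε l w := fun ε l =>
    (hm ε).comp (f := fun w : ℝ => (l, w)) (by fun_prop)
  rw [← integral_signChange_profile hk.pos.ne']
  -- Dominated convergence twice, first in `l` and then in `w`, with a bound independent of `ε`; the
  -- exceptional `w` for a given `l` are `0` and `cos (k * l)`.
  refine tendsto_intervalIntegral_of_bounded (C := C * |1 - -1|)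
    (fun ε => measurable_intervalIntegral (f := gainDensity k H φ ε) (hm ε) _ _) ?_
    (Eventually.of_forall fun l _ => ?_)
  · filter_upwards [self_mem_nhdsWithin] with ε hε l _
    exact abs_intervalIntegral_le (hC ε hε l)
  · refine tendsto_intervalIntegral_of_bounded (C := C)
      (fun ε => hml ε l) ?_ ?_
    · filter_upwards [self_mem_nhdsWithin] with ε hε
      exact hC ε hε l
    · filter_upwards [Measure.ae_ne volume 0, Measure.ae_ne volume (cos (k * l))] with w h1 h2 hw
      rw [Set.uIoc_of_le (by norm_num)] at hw
      exact tendsto_gainDensity hk hH hφ (abs_le.mpr ⟨hw.1.le, hw.2⟩) h1 h2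

lemma tendsto_halfGain (hk : Odd k) (hH : IsNorthernLawn H) (hφ : sin φ ≠ 0) :
    Tendsto (fun ε => halfGain k H φ ε / ε ^ 2) (𝓝[>] 0)
      (𝓝 (4 * π / |sin φ| * (cos (k * φ) - cos φ))) := by
  have hpi := pi_pos
  refine (tendsto_integral_gainDensity hk hH hφ).congr' ?_
  have h1 : ∀ᶠ ε : ℝ in 𝓝[>] 0, ε < 1 := nhdsWithin_le_nhds (gt_mem_nhds one_pos)
  have h2 : ∀ᶠ ε : ℝ in 𝓝[>] 0, ε < π / 2 / dirBound φ :=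
    nhdsWithin_le_nhds (gt_mem_nhds (by have := dirBound_pos hφ; positivity))
  filter_upwards [self_mem_nhdsWithin, h1, h2] with ε hε h1 h2
  have hε' : ε ^ 2 ≠ 0 := pow_ne_zero 2 (ne_of_gt hε)
  rw [halfGain_eq hk hH hφ hε h1.le (by rwa [mul_comm, ← lt_div_iff₀ (dirBound_pos hφ)]),
    mul_div_cancel_left₀ _ hε']
  rfl

end

/-! ### Comparison of the lawns -/

/-- The direction circle is cut into two half circles, and a backward jump of size `φ` is a forward
jump of size `-φ`. Near the equator each half contains just one direction along the parallel, `ω =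
0`, around which to rescale. -/
lemma integral_pairMeasure_eq (φ : ℝ) {F : S2 × S2 → ℝ} (hF : Measurable F) {C : ℝ}
    (hC : ∀ p, |F p| ≤ C) : ∫ p, F p ∂(pairMeasure φ) =
      ∫ x, (∫ ω in -(π / 2)..π / 2, (F (x, jump φ x ω) + F (x, jump (-φ) x ω))) ∂area := by
  have hi : Integrable (fun p : S2 × ℝ => F (p.1, jump φ p.1 p.2))
      (area.prod (volume.restrict (Set.Ico 0 (2 * π)))) :=
    Integrable.of_bound (hF.comp (measurable_pair φ)).aestronglyMeasurable C
      (Eventually.of_forall fun p => hC _)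
  rw [pairMeasure, integral_map (measurable_pair φ).aemeasurable hF.aestronglyMeasurable,
    integral_prod _ hi]
  refine integral_congr_ae (Eventually.of_forall fun x => ?_)
  have hI : ∀ ψ a b, IntervalIntegrable (fun ω => F (x, jump ψ x ω)) volume a b := fun ψ a b =>
    intervalIntegrable_jump (f := fun y => F (x, y))
      (hF.comp (measurable_const.prodMk measurable_id)) (fun y => hC _) ψ x a b
  have hper : Function.Periodic (fun ω => F (x, jump φ x ω)) (2 * π) := fun ω => by
    simp only [jump_periodic φ x ω]
  simp only
  rw [integral_Ico_eq_integral_Ioc, ← intervalIntegral.integral_of_le two_pi_pos.le]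
  have h1 := hper.intervalIntegral_add_eq 0 (-(π / 2))
  rw [zero_add] at h1
  rw [h1, ← intervalIntegral.integral_add_adjacent_intervals (hI φ _ (π / 2)) (hI φ _ _),
    intervalIntegral.integral_add (hI φ _ _) (hI (-φ) _ _)]
  congr 1
  have h2 := intervalIntegral.integral_comp_add_right (a := -(π / 2)) (b := π / 2)
    (fun ω => F (x, jump φ x ω)) π
  simp only [jump_add_pi] at h2
  rw [h2]
  congr 1 <;> ring

lemma pairMeasure_separated_eq_integral {L : Set S2} (hL : MeasurableSet L) (φ : ℝ) :
    (pairMeasure φ).real (separated L) =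
      ∫ p, (1 - spin L p.1 * spin L p.2) / 2 ∂(pairMeasure φ) := by
  rw [← integral_indicator_one (measurableSet_separated hL)]
  refine integral_congr_ae (Eventually.of_forall fun p => ?_)
  by_cases h1 : p.1 ∈ L <;> by_cases h2 : p.2 ∈ L <;> simp [spin, separated, h1, h2]

lemma integrable_mul_pairMeasure (φ : ℝ) {f g : S2 → ℝ} (hf : Measurable f) (hg : Measurable g)
    {C : ℝ} (hfC : ∀ x, |f x| ≤ C) (hgC : ∀ x, |g x| ≤ C) :
    Integrable (fun p : S2 × S2 => f p.1 * g p.2) (pairMeasure φ) := by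
  refine Integrable.of_bound ((hf.comp measurable_fst).mul
    (hg.comp measurable_snd)).aestronglyMeasurable (C * C) (Eventually.of_forall fun p => ?_)
  rw [Real.norm_eq_abs, abs_mul]
  exact mul_le_mul (hfC _) (hgC _) (abs_nonneg _) ((abs_nonneg _).trans (hfC p.1))

lemma integral_mul_pairMeasure_comm {φ : ℝ} (hφ : sin φ ≠ 0) {f g : S2 → ℝ} (hf : Measurable f)
    (hg : Measurable g) :
    ∫ p, f p.1 * g p.2 ∂(pairMeasure φ) = ∫ p, g p.1 * f p.2 ∂(pairMeasure φ) := by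
  have hm : Measurable fun p : S2 × S2 => f p.1 * g p.2 :=
    (hf.comp measurable_fst).mul (hg.comp measurable_snd)
  conv_lhs => rw [← pairMeasure_map_swap hφ]
  rw [integral_map measurable_swap.aemeasurable hm.aestronglyMeasurable]
  exact integral_congr_ae (Eventually.of_forall fun p => mul_comm _ _)

/-- Polarisation of the correlation of a bounded function at the two ends of a jump. -/
lemma integral_mul_pairMeasure_sub {φ : ℝ} (hφ : sin φ ≠ 0) {f g : S2 → ℝ} (hf : Measurable f)
    (hg : Measurable g) {C : ℝ} (hfC : ∀ x, |f x| ≤ C) (hgC : ∀ x, |g x| ≤ C) :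
    ∫ p, f p.1 * f p.2 ∂(pairMeasure φ) - ∫ p, g p.1 * g p.2 ∂(pairMeasure φ) =
      ∫ p, ((f p.1 - g p.1) * ((f p.2 - g p.2) + 2 * g p.2)) ∂(pairMeasure φ) := by
  have iff' := integrable_mul_pairMeasure φ hf hf hfC hfC
  have ifg := integrable_mul_pairMeasure φ hf hg hfC hgC
  have igf := integrable_mul_pairMeasure φ hg hf hgC hfC
  have igg := integrable_mul_pairMeasure φ hg hg hgC hgC
  -- The second bracket is antisymmetric under exchange of the two ends, hence integrates to zero.
  have e1 : ∀ p : S2 × S2, (f p.1 - g p.1) * ((f p.2 - g p.2) + 2 * g p.2) =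
      (f p.1 * f p.2 - g p.1 * g p.2) + (f p.1 * g p.2 - g p.1 * f p.2) := fun p => by ring
  have i1 : Integrable (fun p : S2 × S2 => f p.1 * f p.2 - g p.1 * g p.2) (pairMeasure φ) :=
    iff'.sub igg
  have i2 : Integrable (fun p : S2 × S2 => f p.1 * g p.2 - g p.1 * f p.2) (pairMeasure φ) :=
    ifg.sub igf
  simp only [e1]
  rw [integral_add i1 i2, integral_sub iff' igg, integral_sub ifg igf,
    integral_mul_pairMeasure_comm hφ hf hg, sub_self, add_zero]

lemma pairMeasure_separated_eq_sub {L : Set S2} (hL : MeasurableSet L) (φ : ℝ) :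
    (pairMeasure φ).real (separated L) = ((pairMeasure φ).real Set.univ -
      ∫ p, spin L p.1 * spin L p.2 ∂(pairMeasure φ)) / 2 := by
  have hs := measurable_spin hL
  have hb : ∀ x, |spin L x| ≤ 1 := fun x => (abs_spin L x).le
  rw [pairMeasure_separated_eq_integral hL, integral_div, integral_sub (integrable_const 1)
    (integrable_mul_pairMeasure φ hs hs hb hb)]
  simp

lemma integral_pairMeasure_eq_halfGain {k : ℕ} (hk : Odd k) {H : Set S2} (hH : IsAntipodalLawn H)
    (φ ε : ℝ) :
    ∫ p, lawnDiff k H ε p.1 * (lawnDiff k H ε p.2 + 2 * spin H p.2) ∂(pairMeasure φ) =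
      halfGain k H φ ε + halfGain k H (-φ) ε := by
  have hD : Measurable (lawnDiff k H ε) := measurable_lawnDiff hk hH ε
  set g : S2 → ℝ := fun y => lawnDiff k H ε y + 2 * spin H y with hg
  have hgm : Measurable g := hD.add ((measurable_spin hH.measurableSet).const_mul 2)
  have hgb : ∀ y, |g y| ≤ 4 := fun y => by
    refine (abs_add_le _ _).trans ?_
    rw [abs_mul, abs_spin, abs_two]
    have := abs_lawnDiff_le k H ε y
    linarith
  have hhalf : ∀ ψ, halfGain k H ψ ε =
      ∫ x, (lawnDiff k H ε x * ∫ ω in -(π / 2)..π / 2, g (jump ψ x ω)) ∂area := fun ψ => rfl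
  have hint : ∀ ψ, Integrable
      (fun x => lawnDiff k H ε x * ∫ ω in -(π / 2)..π / 2, g (jump ψ x ω)) area := by
    intro ψ
    have hm : Measurable fun x => ∫ ω in -(π / 2)..π / 2, g (jump ψ x ω) :=
      measurable_intervalIntegral (f := fun x ω => g (jump ψ x ω))
        (hgm.comp (measurable_jump ψ)) _ _
    refine Integrable.of_bound (hD.mul hm).aestronglyMeasurable
      (2 * (4 * |π / 2 - -(π / 2)|)) (Eventually.of_forall fun x => ?_)
    rw [Real.norm_eq_abs, abs_mul]
    exact mul_le_mul (abs_lawnDiff_le k H ε x) (abs_intervalIntegral_le fun ω _ => hgb _)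
      (abs_nonneg _) (by norm_num)
  have hF : Measurable fun p : S2 × S2 => lawnDiff k H ε p.1 * g p.2 :=
    (hD.comp measurable_fst).mul (hgm.comp measurable_snd)
  have hFb : ∀ p : S2 × S2, |lawnDiff k H ε p.1 * g p.2| ≤ 2 * 4 := fun p => by
    rw [abs_mul]
    exact mul_le_mul (abs_lawnDiff_le k H ε _) (hgb _) (abs_nonneg _) (by norm_num)
  rw [integral_pairMeasure_eq φ hF hFb, hhalf, hhalf, ← integral_add (hint φ) (hint (-φ))]
  refine integral_congr_ae (Eventually.of_forall fun x => ?_)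
  simp only
  rw [← mul_add, ← intervalIntegral.integral_add (intervalIntegrable_jump hgm hgb φ x _ _)
    (intervalIntegrable_jump hgm hgb (-φ) x _ _), ← intervalIntegral.integral_const_mul]
  simp only [mul_add]

lemma pairMeasure_separated_sub {k : ℕ} (hk : Odd k) {H : Set S2} (hH : IsAntipodalLawn H)
    {φ : ℝ} (hφ : sin φ ≠ 0) (ε : ℝ) :
    (pairMeasure φ).real (separated H) - (pairMeasure φ).real (separated (waveLawn k H ε)) =
      (halfGain k H φ ε + halfGain k H (-φ) ε) / 2 := by
  have hL := isAntipodalLawn_waveLawn hk hH ε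
  have hb : ∀ (L : Set S2) x, |spin L x| ≤ 1 := fun L x => (abs_spin L x).le
  have h := integral_mul_pairMeasure_sub hφ (measurable_spin hL.measurableSet)
    (measurable_spin hH.measurableSet) (hb _) (hb _)
  rw [← integral_pairMeasure_eq_halfGain hk hH φ ε, pairMeasure_separated_eq_sub hH.measurableSet,
    pairMeasure_separated_eq_sub hL.measurableSet]
  simp only [lawnDiff]
  linarith

/-! ### Failure of hemispheres for all other jump sizes -/

/-- If `φ` is not a unit fraction of `π`, some odd multiple of `φ` is closer to a full turn
than `φ` is to zero. -/
lemma exists_odd_cos_lt {φ : ℝ} (hφ₀ : 0 < φ) (hφ₁ : φ < π / 2)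
    (h : ¬∃ q : ℕ, 1 < q ∧ φ = π / q) : ∃ k : ℕ, Odd k ∧ cos φ < cos (k * φ) := by
  obtain ⟨n, hn1, hn2⟩ : ∃ n : ℕ, (n : ℝ) * φ ≤ π ∧ π < (n + 1) * φ := by
    refine ⟨⌊π / φ⌋₊, ?_, ?_⟩
    · rw [← le_div_iff₀ hφ₀]
      exact Nat.floor_le (by have := pi_pos; positivity)
    · rw [← div_lt_iff₀ hφ₀]
      exact Nat.lt_floor_add_one _
  have hn : 1 < n := by
    by_contra hc
    have : (n : ℝ) ≤ 1 := by exact_mod_cast not_lt.mp hc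
    nlinarith
  have hne : (n : ℝ) * φ ≠ π := by
    intro he
    refine h ⟨n, hn, ?_⟩
    have : (n : ℝ) ≠ 0 := by positivity
    rw [← he]; field_simp
  have hlt : (n : ℝ) * φ < π := lt_of_le_of_ne hn1 hne
  refine ⟨2 * n + 1, odd_two_mul_add_one n, ?_⟩
  -- The difference equals `2 * (n * φ - π) + φ` and also `2 * ((n + 1) * φ - π) - φ`, where `n * φ
  -- < π < (n + 1) * φ`.
  have h1 : |((2 * n + 1 : ℕ) : ℝ) * φ - 2 * π| < φ := by
    rw [abs_lt]
    push_cast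
    constructor <;> linarith
  rw [← Real.cos_sub_two_pi (_ * φ), ← Real.cos_abs (_ - _)]
  exact Real.cos_lt_cos_of_nonneg_of_le_pi (abs_nonneg _) (by linarith) h1

/-- The north pole. -/
noncomputable def northPole : S2 :=
  ⟨!₂[0, 0, 1], by simp [EuclideanSpace.norm_eq, Fin.sum_univ_three]⟩

lemma exists_act_eq (x y : S2) : ∃ g : O3, act g x = y := by
  obtain ⟨g, hg, -⟩ := exists_act_pair (φ := π / 2) (by simp) (inner_jump (π / 2) x 0)
    (inner_jump (π / 2) y 0)
  exact ⟨g, hg⟩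

/-- If `φ` is not a unit fraction of `π`, hemispherical lawns are not optimal. -/
theorem exists_retentionProb_gt {φ : ℝ} (hφ₀ : 0 < φ) (hφ₁ : φ < π / 2)
    (h : ¬∃ q : ℕ, 1 < q ∧ φ = π / q) {H : Set S2} (hH : IsHemisphericalLawn H) :
    ∃ L, IsAntipodalLawn L ∧ retentionProb φ H < retentionProb φ L := by
  obtain ⟨n, hn⟩ := hH.exists_pole
  obtain ⟨g, hg⟩ := exists_act_eq northPole n
  obtain ⟨k, hk, hcos⟩ := exists_odd_cos_lt hφ₀ hφ₁ h
  have hsin : 0 < sin φ := sin_pos_of_pos_of_lt_pi hφ₀ (by linarith [pi_pos])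
  -- Turning the pole of `H` to the north pole; the wavy lawn built from `K` is turned back at the
  -- end, and neither turn changes the separation mass.
  set K := act g ⁻¹' H with hK
  have hKL : IsNorthernLawn K := by
    refine ⟨hH.toIsAntipodalLawn.preimage_act g, fun x hx => hn ?_⟩
    rw [Set.mem_ofPred_eq, ← hg, inner_act, inner_eq_sum]
    simpa [northPole] using hx
  have hlim := (tendsto_halfGain hk hKL hsin.ne').add
    (tendsto_halfGain (φ := -φ) hk hKL (by rw [sin_neg]; exact (neg_neg_of_pos hsin).ne))
  have hpos : 0 < 4 * π / |sin φ| * (cos (k * φ) - cos φ) +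
      4 * π / |sin (-φ)| * (cos (k * -φ) - cos (-φ)) := by
    rw [sin_neg, abs_neg, cos_neg, mul_neg, cos_neg, abs_of_pos hsin]
    have hpi := pi_pos
    have : 0 < cos (k * φ) - cos φ := sub_pos.mpr hcos
    positivity
  obtain ⟨ε, hε, hε0⟩ := ((hlim.eventually (lt_mem_nhds hpos)).and self_mem_nhdsWithin).exists
  have hε0' : 0 < ε := hε0
  rw [← add_div] at hε
  have hgain : 0 < halfGain k K φ ε + halfGain k K (-φ) ε := by
    by_contra hc
    exact absurd hε (div_nonpos_of_nonpos_of_nonneg (not_lt.mp hc) (sq_nonneg ε)).not_gt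
  have hL := isAntipodalLawn_waveLawn hk hKL.toIsAntipodalLawn ε
  refine ⟨act g⁻¹ ⁻¹' waveLawn k K ε, hL.preimage_act _, ?_⟩
  rw [← not_le, retentionProb_le_iff (hL.preimage_act _) hH.toIsAntipodalLawn, not_le,
    pairMeasure_separated_preimage_act hL.measurableSet,
    ← pairMeasure_separated_preimage_act hH.measurableSet φ g]
  have := pairMeasure_separated_sub hk hKL.toIsAntipodalLawn hsin.ne' ε
  linarith

end Grasshopper

theorem mainTheorem1 (φ : ℝ) (hφ₀ : 0 < φ) (hφ₁ : φ < π / 2)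
    (H : Set Grasshopper.S2) (hH : Grasshopper.IsHemisphericalLawn H) :
    (∀ L : Set Grasshopper.S2, Grasshopper.IsAntipodalLawn L →
        Grasshopper.retentionProb φ L ≤ Grasshopper.retentionProb φ H) ↔
      ∃ q : ℕ, 1 < q ∧ φ = π / q := by
  constructor
  · intro h
    by_contra hc
    obtain ⟨L, hL, hlt⟩ := Grasshopper.exists_retentionProb_gt hφ₀ hφ₁ hc hH
    exact absurd (h L hL) (not_le.mpr hlt)
  · rintro ⟨q, hq, rfl⟩ L hL
    exact Grasshopper.retentionProb_le_hemisphere hq hL hH
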